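/- All logarithms are to base 2. **Biregular irreducible functions.** A biregular irreducible (BRI) function is a surjective map $f:\mathcal S\times\mathcal X\to\mathcal N$ between finite sets together with a regularity set $\mathcal M\subseteq\mathcal N$ and integers $d_{\mathcal S},d_{\mathcal X}\ge 1$ such that for every $m\in\mathcal M$: $|\{x:f(s,x)=m\}|=d_{\mathcal S}$ for all $s$; $|\{s:f(s,x)=m\}|=d_{\mathcal X}$ for all $x$; and the symmetric stochastic matrix $P_{f,m}(x,x')=|\{s:f(s,x)=f(s,x')=m\}|/(d_{\mathcal S}d_{\mathcal X})$ with eigenvalues $\mu_1\ge\mu_2\ge\dots\ge\mu_{|\mathcal X|}$ has second-largest eigenvalue modulus $\lambda_2(f,m)=\max(|\mu_2|,|\mu_{|\mathcal X|}|)<1$. **Codes.** Let $T:\mathcal A\to\mathcal Y$ and $U:\mathcal A\to\mathcal Z$ be discrete channels (finite alphabets, stochastic matrices) with memoryless extensions $T^n,U^n$; the pair $(T,U)$ is a discrete wiretap channel without input constraints. A blocklength-$n$ code with finite message set $\tilde{\mathcal X}$ consists of a channel $\phi:\tilde{\mathcal X}\to\mathcal A^n$ and a map $\psi:\mathcal Y^n\to\tilde{\mathcal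 X}$; $e(\phi,\psi)$ denotes its maximal error probability over $T^n$. Codes $(\phi_n,\psi_n)$ with message sets $\tilde{\mathcal X}_n$ achieve a rate $r'$ for $T$ if $\liminf_n\frac1n\log|\tilde{\mathcal X}_n|\ge r'$ and $e(\phi_n,\psi_n)\to0$. **Modular BRI schemes.** Given a BRI function $f:\mathcal S\times\mathcal X\to\mathcal N$ with regularity set $\mathcal M$ and a code $(\phi,\psi)$ with message set $\mathcal X$, the scheme $\Pi(f,\phi,\psi)$ is the seeded wiretap code with seed set $\mathcal S$, message set $\mathcal M$, encoder $\xi(a|s,m)=\sum_x\frac{1}{d_{\mathcal S}}1_{\{f(s,x)=m\}}\phi(a|x)$ and decoder $\zeta(s,y)=f(s,\psi(y))$. If the message set $\tilde{\mathcal X}$ of the code is larger, $\mathcal X$ is identified with an arbitrary subset of $\tilde{\mathcal X}$ of the same size, the encoder is restricted to it, and decoder outputs outside of $\mathcal X$ are replaced by arbitrary elements of $\mathcal X$. The maximal error probability is $e(\Pi)=\max_{s\in\mathcal S,\,m\in\mathcal M}(\xi T^n)(\{y:\zeta(s,y)\ne m\}|s,m)$, and the semantic security leakage is $L_{\mathrm{sem}}(\Pi)=\max_{P_M}I(M\wedge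 Z,S)$, where $S$ is uniform on $\mathcal S$ and independent of $M\sim P_M$, $Z$ is generated by $(S,M)$ via $\xi U^n$, and $P_M$ ranges over all distributions on $\mathcal M$. A sequence of such schemes achieves the rate $R$ with semantic security if $\liminf_n\frac1n\log|\mathcal M_n|\ge R$, $e(\Pi_n)\to0$ and $L_{\mathrm{sem}}(\Pi_n)\to0$. For a probability distribution $P$ on $\mathcal A$ and $\delta>0$ let $T^n_{P,\delta}$ be the set of $(a_1,\dots,a_n)\in\mathcal A^n$ such that for every $a\in\mathcal A$: $\bigl|\frac1n|\{i:a_i=a\}|-P(a)\bigr|\le\delta$, and $\{i:a_i=a\}=\varnothing$ if $P(a)=0$. Let $I(P,U)$ be the mutual information of input and output of $U$ under the input distribution $P$. **Lemma.** There is a positive function $\gamma_d(\delta,|\mathcal A|,|\mathcal Z|)$, depending only on $\delta>0$ and the sizes of the alphabets $\mathcal A$ and $\mathcal Z$, with $\gamma_d(\delta,|\mathcal A|,|\mathcal Z|)\to0$ as $\delta\downarrow0$ for all fixed $|\mathcal A|,|\mathcal Z|$, such that the following holds. Let $r\ge0$, $0\le t<1$, and let $f_n:\mathcal S_n\times\mathcal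 X_n\to\mathcal N_n$ ($n\ge1$) be BRI functions with regularity sets $\mathcal M_n$ such that $$\lim_{n\to\infty}\frac{\log|\mathcal X_n|}{n}=r,\qquad \lim_{n\to\infty}\frac{\log|\mathcal M_n|}{\log|\mathcal X_n|}=1-t,\qquad \liminf_{n\to\infty}\frac{\min_{m\in\mathcal M_n}(-\log\lambda_2(f_n,m))}{\log|\mathcal X_n|}\ge t.$$ Let $(T,U)$ be a discrete wiretap channel without input constraints, and let $(\phi_n,\psi_n)$ be blocklength-$n$ codes with message sets $\tilde{\mathcal X}_n$ which achieve a rate strictly larger than $r$ for $T$. Then $|\mathcal X_n|\le|\tilde{\mathcal X}_n|$ for all sufficiently large $n$, and the modular BRI schemes $\Pi(f_n,\phi_n,\psi_n)$ (defined for these $n$) have the following properties. 1. If $tr>\max_PI(P,U)$, where $P$ ranges over all probability distributions on $\mathcal A$, then they achieve the rate $(1-t)r$ with semantic security, and $L_{\mathrm{sem}}(\Pi(f_n,\phi_n,\psi_n))$ decreases exponentially in $n$. 2. If there are a probability distribution $P$ on $\mathcal A$ and a $\delta_1>0$ such that $\phi_n(T^n_{P,\delta_1}|x)=1$ for all $n\geq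 1$ and all $x\in\tilde{\mathcal X}_n$, then the same conclusion holds already if $tr>I(P,U)+\gamma_d(\delta_1,|\mathcal A|,|\mathcal Z|)$. -/

import Mathlib

open Filter Topology

noncomputable section

namespace BRIWiretap

/-! ### Discrete channels and mutual information -/

/-- A discrete channel from `A` to `Z`: a stochastic matrix with rows indexed by `A`. -/
structure Channel (A Z : Type*) [Fintype Z] where
  prob : A → Z → ℝ
  nonneg : ∀ a z, 0 ≤ prob a z
  sum_eq_one : ∀ a, ∑ z, prob a z = 1

/-- Concatenation of channels (matrix product). -/
def Channel.comp {X Y Z : Type*} [Fintype Y] [Fintype Z]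
    (V : Channel X Y) (W : Channel Y Z) : Channel X Z where
  prob x z := ∑ y, V.prob x y * W.prob y z
  nonneg x z := Finset.sum_nonneg fun y _ => mul_nonneg (V.nonneg x y) (W.nonneg y z)
  sum_eq_one x := by
    rw [Finset.sum_comm]
    simp_rw [← Finset.mul_sum, W.sum_eq_one, mul_one, V.sum_eq_one]

/-- The blocklength-`n` memoryless extension of a channel. -/
def Channel.memoryless {A Z : Type*} [Fintype Z] (W : Channel A Z) (n : ℕ) :
    Channel (Fin n → A) (Fin n → Z) where
  prob a z := ∏ i, W.prob (a i) (z i)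
  nonneg a z := Finset.prod_nonneg fun i _ => W.nonneg (a i) (z i)
  sum_eq_one a := by
    rw [← Fintype.prod_sum fun i z => W.prob (a i) z]
    simp [W.sum_eq_one]

/-- Mutual information in bits of a pair of random variables with joint probability mass
function `p` on `α × β`, i.e. the Kullback-Leibler divergence of `p` from the product of its
marginals (terms with `p x y = 0` vanish, and the marginals are positive wherever `p` is). -/
def mutualInfo {α β : Type*} [Fintype α] [Fintype β] (p : α → β → ℝ) : ℝ :=
  ∑ x, ∑ y, p x y * Real.logb 2 (p x y / ((∑ y', p x y') * (∑ x', p x' y)))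

/-- `I(P, W)`: mutual information of input and output of `W` under the input distribution `P`. -/
def channelInfo {A Z : Type*} [Fintype A] [Fintype Z]
    (P : stdSimplex ℝ A) (W : Channel A Z) : ℝ :=
  mutualInfo fun a z => (P : A → ℝ) a * W.prob a z

/-- `max_P I(P, W)`, where `P` ranges over all probability distributions on `A`. -/
def maxChannelInfo {A Z : Type*} [Fintype A] [Fintype Z] (W : Channel A Z) : ℝ :=
  ⨆ P : stdSimplex ℝ A, channelInfo P W

/-- The `δ`-typical set of `P` in `Aⁿ`. -/
def typicalSet {A : Type*} [Fintype A] [DecidableEq A]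
    (P : stdSimplex ℝ A) (δ : ℝ) (n : ℕ) : Set (Fin n → A) :=
  {a | ∀ b : A,
    |((Finset.univ.filter fun i => a i = b).card : ℝ) / n - (P : A → ℝ) b| ≤ δ ∧
      ((P : A → ℝ) b = 0 → ∀ i, a i ≠ b)}

/-! ### Biregular irreducible functions -/

/-- For a symmetric real matrix with eigenvalues `μ₁ ≥ μ₂ ≥ ⋯ ≥ μ_k` (with multiplicity), the
number `max (|μ₂|, |μ_k|)`; it is `0` if there is no second eigenvalue. -/
def secondEigenvalueModulus {X : Type*} [Fintype X] [DecidableEq X]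
    (M : Matrix X X ℝ) (hM : M.IsHermitian) : ℝ :=
  if h : 1 < Fintype.card X then
    max |hM.eigenvalues₀ ⟨1, h⟩| |hM.eigenvalues₀ ⟨Fintype.card X - 1, by omega⟩|
  else 0

/-- The matrix `P_{f,m}(x,x') = |{s : f(s,x) = f(s,x') = m}| / (d_S d_X)`. -/
def transitionMatrix {S X N : Type*} [Fintype S] [DecidableEq N]
    (f : S → X → N) (dS dX : ℕ) (m : N) : Matrix X X ℝ :=
  Matrix.of fun x x' =>
    ((Finset.univ.filter fun s => f s x = m ∧ f s x' = m).card : ℝ) / ((dS : ℝ) * (dX : ℝ))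

theorem transitionMatrix_isHermitian {S X N : Type*} [Fintype S] [DecidableEq N]
    (f : S → X → N) (dS dX : ℕ) (m : N) : (transitionMatrix f dS dX m).IsHermitian := by
  ext x x'
  simp [transitionMatrix, Matrix.conjTranspose_apply, and_comm]

/-- A biregular irreducible function `f : S × X → N` together with its regularity set and its
degrees. -/
structure BRIFunction (S X N : Type*) [Fintype S] [Fintype X] [DecidableEq X]
    [DecidableEq N] where
  toFun : S → X → N
  surjective : ∀ k, ∃ s x, toFun s x = k
  /-- the regularity set -/
  regSet : Finset N
  dS : ℕ
  dX : ℕ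
  dS_pos : 0 < dS
  dX_pos : 0 < dX
  S_regular : ∀ m ∈ regSet, ∀ s, (Finset.univ.filter fun x => toFun s x = m).card = dS
  X_regular : ∀ m ∈ regSet, ∀ x, (Finset.univ.filter fun s => toFun s x = m).card = dX
  irreducible : ∀ m ∈ regSet,
    secondEigenvalueModulus (transitionMatrix toFun dS dX m)
      (transitionMatrix_isHermitian toFun dS dX m) < 1

namespace BRIFunction

variable {S X N : Type*} [Fintype S] [Fintype X] [DecidableEq X] [DecidableEq N]

/-- `λ₂(f,m)`, the second-largest eigenvalue modulus of `P_{f,m}`. -/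
def lambda2 (f : BRIFunction S X N) (m : N) : ℝ :=
  secondEigenvalueModulus (transitionMatrix f.toFun f.dS f.dX m)
    (transitionMatrix_isHermitian f.toFun f.dS f.dX m)

/-- The randomized inverse `f_s⁻¹(x | m) = 1{f(s,x) = m} / d_S`, as a channel with input
`(s, m)`. -/
def randInverse (f : BRIFunction S X N) : Channel (S × f.regSet) X where
  prob p x := if f.toFun p.1 x = p.2 then 1 / (f.dS : ℝ) else 0
  nonneg p x := by split_ifs <;> positivity
  sum_eq_one p := by
    have hd : (f.dS : ℝ) ≠ 0 := by exact_mod_cast f.dS_pos.ne'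
    rw [← Finset.sum_filter, Finset.sum_const, f.S_regular p.2 p.2.2 p.1, nsmul_eq_mul]
    field_simp

end BRIFunction

/-- `-log₂ x` as an extended real, equal to `+∞` at `x = 0`. -/
def negLog2 (x : ℝ) : EReal :=
  if x ≤ 0 then ⊤ else ((-Real.logb 2 x : ℝ) : EReal)

/-- The three asymptotic conditions, with parameters `r` and `t`, on a sequence of biregular
irreducible functions: `log |X_n| / n → r`, `log |M_n| / log |X_n| → 1 - t`, and
`liminf (min_m (-log λ₂(f_n,m))) / log |X_n| ≥ t`. -/
structure HasAsymptotics {S X N : ℕ → Type*} [∀ n, Fintype (S n)] [∀ n, Fintype (X n)]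
    [∀ n, DecidableEq (X n)] [∀ n, DecidableEq (N n)]
    (f : ∀ n, BRIFunction (S n) (X n) (N n)) (r t : ℝ) : Prop where
  log_card : Tendsto (fun n : ℕ => Real.logb 2 (Fintype.card (X n)) / n) atTop (𝓝 r)
  rate : Tendsto
    (fun n => Real.logb 2 ((f n).regSet.card) / Real.logb 2 (Fintype.card (X n)))
    atTop (𝓝 (1 - t))
  eigenvalue : (t : EReal) ≤ liminf
    (fun n => (⨅ m ∈ (f n).regSet, negLog2 ((f n).lambda2 m)) /
      ((Real.logb 2 (Fintype.card (X n)) : ℝ) : EReal)) atTop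

/-! ### Error-correcting codes -/

/-- An error-correcting code with message set `X`, channel input alphabet `A` and channel output
alphabet `Y`; the encoder is a channel, the decoder a mapping. -/
structure ECCode (X A Y : Type*) [Fintype A] where
  enc : Channel X A
  dec : Y → X

namespace ECCode

variable {X A Y : Type*} [Fintype X] [DecidableEq X] [Fintype A] [Fintype Y]

/-- Maximal error probability of a code over the channel `T`. -/
def errorProb (C : ECCode X A Y) (T : Channel A Y) : ℝ :=
  ⨆ x : X, ∑ y ∈ Finset.univ.filter (fun y => C.dec y ≠ x), (C.enc.comp T).prob x y

end ECCode

/-- `C'` arises from `C` by embedding its message set `X'` in the message set `X` of `C` and using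
only these messages; where the decoder of `C` outputs a message outside of the embedded set, the
output of the decoder of `C'` is arbitrary. -/
def IsRestriction {X' X A Y : Type*} [Fintype A] (C' : ECCode X' A Y) (C : ECCode X A Y) : Prop :=
  ∃ ι : X' ↪ X, (∀ x, C'.enc.prob x = C.enc.prob (ι x)) ∧
    ∀ y x, C.dec y = ι x → C'.dec y = x

/-- A sequence of blocklength-`n` codes for the memoryless extensions of `T` achieves the
rate `r`. -/
def CodesAchieveRate {A Y : Type*} [Fintype A] [Fintype Y] (T : Channel A Y)
    {X : ℕ → Type*} [∀ n, Fintype (X n)] [∀ n, DecidableEq (X n)]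
    (C : ∀ n, ECCode (X n) (Fin n → A) (Fin n → Y)) (r : ℝ) : Prop :=
  (r : EReal) ≤ liminf
      (fun n : ℕ => ((Real.logb 2 (Fintype.card (X n)) / n : ℝ) : EReal)) atTop ∧
    Tendsto (fun n => (C n).errorProb (T.memoryless n)) atTop (𝓝 0)

/-! ### Seeded wiretap codes -/

/-- A seeded wiretap code with seed set `S` and message set `M ⊆ N`. The decoder takes values in
`N`; a value outside of `M` is a decoding error. -/
structure SeededWiretapCode (S : Type*) {N : Type*} (M : Finset N) (A Y : Type*) [Fintype A] where
  enc : Channel (S × M) A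
  dec : S → Y → N

namespace SeededWiretapCode

variable {S N A Y Z : Type*} {M : Finset N} [Fintype S] [DecidableEq N] [Fintype A] [Fintype Y]
  [Fintype Z]

/-- Maximal error probability over seeds and messages. -/
def errorProb (C : SeededWiretapCode S M A Y) (T : Channel A Y) : ℝ :=
  ⨆ p : S × M, ∑ y ∈ Finset.univ.filter (fun y => C.dec p.1 y ≠ p.2), (C.enc.comp T).prob p y

/-- Semantic security information leakage: the maximum over all message distributions `P_M` of
`I(M ∧ (Z, S))`, where the seed `S` is uniform and independent of `M`, and `Z` is generated by
`(S, M)` via the concatenation of the encoder with the eavesdropper's channel `U`. -/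
def semLeakage (C : SeededWiretapCode S M A Y) (U : Channel A Z) : ℝ :=
  ⨆ P : stdSimplex ℝ M, mutualInfo fun (m : M) (q : Z × S) =>
    (P : M → ℝ) m * (1 / (Fintype.card S : ℝ)) * (C.enc.comp U).prob (q.2, m) q.1

end SeededWiretapCode

/-- The modular BRI scheme `Π(f, φ, ψ)`: the encoder is the concatenation of the randomized
inverse of `f` with `φ`, and the decoder is `ζ(s, y) = f(s, ψ(y))`. -/
def modularBRI {S X N A Y : Type*} [Fintype S] [Fintype X] [DecidableEq X] [DecidableEq N]
    [Fintype A] (f : BRIFunction S X N) (C : ECCode X A Y) :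
    SeededWiretapCode S f.regSet A Y where
  enc := f.randInverse.comp C.enc
  dec s y := f.toFun s (C.dec y)

/-- A sequence of blocklength-`n` seeded wiretap codes for the memoryless wiretap channel `(T, U)`
without input constraints achieves the rate `R` with semantic security. -/
structure AchievesSemanticRate {A Y Z : Type*} [Fintype A] [Fintype Y] [Fintype Z]
    (T : Channel A Y) (U : Channel A Z) {S N : ℕ → Type*} [∀ n, Fintype (S n)]
    [∀ n, DecidableEq (N n)] {M : ∀ n, Finset (N n)}
    (C : ∀ n, SeededWiretapCode (S n) (M n) (Fin n → A) (Fin n → Y)) (R : ℝ) : Prop where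
  rate : (R : EReal) ≤ liminf
    (fun n : ℕ => ((Real.logb 2 ((M n).card) / n : ℝ) : EReal)) atTop
  error : Tendsto (fun n => (C n).errorProb (T.memoryless n)) atTop (𝓝 0)
  leakage : Tendsto (fun n => (C n).semLeakage (U.memoryless n)) atTop (𝓝 0)

/-- The semantic security leakage decreases exponentially in the blocklength. -/
def ExponentialLeakage {A Y Z : Type*} [Fintype A] [Fintype Y] [Fintype Z]
    (U : Channel A Z) {S N : ℕ → Type*} [∀ n, Fintype (S n)] [∀ n, DecidableEq (N n)]
    {M : ∀ n, Finset (N n)}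
    (C : ∀ n, SeededWiretapCode (S n) (M n) (Fin n → A) (Fin n → Y)) : Prop :=
  ∃ K c : ℝ, 0 < c ∧ ∀ n : ℕ, (C n).semLeakage (U.memoryless n) ≤ K * (2 : ℝ) ^ (-(c * n))

end BRIWiretap

end

/-!
Conditionally on each message, the eavesdropper's observation has the same law `Q`, the output law
for a uniform input of the error-correcting code. The leakage is therefore bounded by the divergence
of the law of (observation, seed) from `Q × uniform`, and, the density being at most `|X|`, by a
factor `1 + ln |X|`, which is linear in the blocklength, times an `ℓ¹` distance
(`mutualInfo_le_l1`, `semLeakage_le_of_l1_le`).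

The distance is estimated by a second moment over the random seed. For a vector `w` on `X`, the
average of `w` over `f_s⁻¹(m)` has variance at most `λ₂(f,m) ∑ w² / |X|`
(`BRIFunction.sum_sq_randInverse_sub_le`): the variance is `1 / |X|` times the quadratic form of
`P_{f,m}` at the centred vector, and the constants are the only eigenvectors with eigenvalue of
modulus above `λ₂`.
Second moments of the channel may be too large, so the likelihoods `Uⁿ(z|a)` are truncated at
`K q(z)` for a suitable measure `q`. The distance is then at most `√(λ₂ · K · mass of q)` plus twice the
largest tail probability (`semLeakage_le_of_truncation`).

For `q` one takes the sum, over the polynomially many types `P` of words of length `n`, of the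
product measures of the outputs of `U` under `P`, each `P` slightly mixed with the uniform
distribution so that the information density is bounded uniformly in `P`. A Chernoff bound shows
that `K = exp (n (R + 2κ))` leaves exponentially small tails for every word whose type has mutual
information at most `R` nats (`exists_universal_measure`). Since `λ₂` is at most
`2 ^ (-n (t r - o(1)))`, the leakage decays exponentially as soon as the types of all words the code
uses have information at most some `R < t r` (`exponentialLeakage_of_channelInfo_le`). In the first part
of the theorem this `R` is the maximal information. In the second part, all types are within `δ₁`
of `P`, and a modulus of continuity for the mutual information that does not depend on the channel
(`infoModulus`) provides `R`.
-/

namespace BRIWiretap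

/-! ### Mutual information -/

theorem mutualInfo_nonneg {α β : Type*} [Fintype α] [Fintype β] {p : α → β → ℝ}
    (hp : ∀ x y, 0 ≤ p x y) (hsum : ∑ x, ∑ y, p x y = 1) : 0 ≤ mutualInfo p := by
  have hl : 0 < Real.log 2 := Real.log_pos one_lt_two
  have key : ∀ x y, (p x y - (∑ y', p x y') * (∑ x', p x' y)) / Real.log 2 ≤
      p x y * Real.logb 2 (p x y / ((∑ y', p x y') * (∑ x', p x' y))) := by
    intro x y
    have hx : p x y ≤ ∑ y', p x y' :=
      Finset.single_le_sum (f := fun y' => p x y') (fun i _ => hp x i) (Finset.mem_univ y)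
    have hy : p x y ≤ ∑ x', p x' y :=
      Finset.single_le_sum (f := fun x' => p x' y) (fun i _ => hp i y) (Finset.mem_univ x)
    rw [Real.logb, ← mul_div_assoc]
    refine div_le_div_of_nonneg_right ?_ hl.le
    rcases (hp x y).eq_or_lt with h0 | h0
    · rw [← h0] at hx hy ⊢
      simpa using mul_nonneg hx hy
    · have hpos : 0 < (∑ y', p x y') * (∑ x', p x' y) := mul_pos (h0.trans_le hx) (h0.trans_le hy)
      have h := mul_le_mul_of_nonneg_left
        (Real.one_sub_inv_le_log_of_pos (div_pos h0 hpos)) h0.le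
      rw [inv_div, mul_sub, mul_one, mul_div_cancel₀ _ h0.ne'] at h
      exact h
  refine le_trans (le_of_eq ?_) (Finset.sum_le_sum fun x _ => Finset.sum_le_sum fun y _ => key x y)
  have h2 : ∑ x, ∑ y, (∑ y', p x y') * (∑ x', p x' y) = 1 := by
    rw [← Finset.sum_mul_sum, hsum, Finset.sum_comm, hsum, one_mul]
  simp_rw [← Finset.sum_div, Finset.sum_sub_distrib]
  rw [h2, hsum, sub_self, zero_div]

/-- The tangent-line bound that turns a divergence into a total variation distance at the cost
of a factor logarithmic in the density bound `L`. -/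
theorem mul_log_le_abs_sub_one {g L : ℝ} (hg : 0 ≤ g) (hgL : g ≤ L) (hL : 1 ≤ L) :
    g * Real.log g ≤ (1 + Real.log L) * |g - 1| := by
  have hlL : 0 ≤ Real.log L := Real.log_nonneg hL
  rcases le_total g 1 with h | h
  · exact (mul_nonpos_of_nonneg_of_nonpos hg (Real.log_nonpos hg h)).trans (by positivity)
  · rw [abs_of_nonneg (by linarith)]
    have h0 : 0 < g := by linarith
    have h1 : Real.log g ≤ g - 1 := Real.log_le_sub_one_of_pos h0
    have h2 : Real.log g ≤ Real.log L := Real.log_le_log h0 hgL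
    nlinarith [mul_le_mul_of_nonneg_left h2 (by linarith : 0 ≤ g - 1)]

/-- Mutual information is at most a multiple of the `ℓ¹` distance of the joint distribution from
the product of its first marginal with an arbitrary distribution `ρ`, if the joint distribution
has a density bounded by `L` with respect to that product. -/
theorem mutualInfo_le_l1 {α β : Type*} [Fintype α] [Fintype β] {p : α → β → ℝ} {ρ : β → ℝ}
    {L : ℝ} (hL : 1 ≤ L) (hp : ∀ x y, 0 ≤ p x y) (hsum : ∑ x, ∑ y, p x y = 1)
    (hρ : ∀ y, 0 ≤ ρ y) (hρsum : ∑ y, ρ y = 1)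
    (hdens : ∀ x y, p x y ≤ L * ((∑ y', p x y') * ρ y)) :
    mutualInfo p ≤
      (1 + Real.log L) / Real.log 2 * ∑ x, ∑ y, |p x y - (∑ y', p x y') * ρ y| := by
  have hl : 0 < Real.log 2 := Real.log_pos one_lt_two
  have hlL : 0 ≤ Real.log L := Real.log_nonneg hL
  -- replacing the true second marginal by `ρ` costs a divergence, which is nonnegative in total
  have key : ∀ x y, p x y * Real.log (p x y / ((∑ y', p x y') * (∑ x', p x' y))) ≤
      (1 + Real.log L) * |p x y - (∑ y', p x y') * ρ y| +
        (p x y * (ρ y / ∑ x', p x' y) - p x y) := by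
    intro x y
    have hx : p x y ≤ ∑ y', p x y' :=
      Finset.single_le_sum (f := fun y' => p x y') (fun i _ => hp x i) (Finset.mem_univ y)
    have hy : p x y ≤ ∑ x', p x' y :=
      Finset.single_le_sum (f := fun x' => p x' y) (fun i _ => hp i y) (Finset.mem_univ x)
    have hd := hdens x y
    set a := ∑ y', p x y'
    set b := ∑ x', p x' y
    rcases (hp x y).eq_or_lt with h0 | h0
    · rw [← h0]; simp only [zero_mul, sub_zero, add_zero]; positivity
    · have ha : 0 < a := h0.trans_le hx
      have hb : 0 < b := h0.trans_le hy
      have hr : 0 < ρ y := by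
        rcases (hρ y).eq_or_lt with h | h
        · rw [← h] at hd; simp at hd; linarith
        · exact h
      have har : 0 < a * ρ y := mul_pos ha hr
      have h1 := mul_log_le_abs_sub_one (g := p x y / (a * ρ y)) (by positivity)
        (by rwa [div_le_iff₀ har]) hL
      have h2 : Real.log (p x y / (a * b)) =
          Real.log (p x y / (a * ρ y)) + Real.log (ρ y / b) := by
        rw [← Real.log_mul (by positivity) (by positivity)]
        congr 1
        field_simp
      have h3 : Real.log (ρ y / b) ≤ ρ y / b - 1 := Real.log_le_sub_one_of_pos (by positivity)
      have h4 : (a * ρ y) * |p x y / (a * ρ y) - 1| = |p x y - a * ρ y| := by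
        rw [← abs_of_pos har, ← abs_mul, abs_of_pos har, mul_sub, mul_div_cancel₀ _ har.ne',
            mul_one]
      have h5 : (a * ρ y) * (p x y / (a * ρ y)) = p x y := mul_div_cancel₀ _ har.ne'
      have h6 := mul_le_mul_of_nonneg_left h1 har.le
      have h7 := mul_le_mul_of_nonneg_left h3 h0.le
      rw [← mul_assoc, h5, mul_left_comm, h4] at h6
      rw [h2, mul_add]
      linarith
  have hneg : ∑ x, ∑ y, (p x y * (ρ y / ∑ x', p x' y) - p x y) ≤ 0 := by
    simp_rw [Finset.sum_sub_distrib]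
    rw [hsum, Finset.sum_comm, ← hρsum, sub_nonpos]
    refine Finset.sum_le_sum fun y _ => ?_
    rw [← Finset.sum_mul]
    rcases eq_or_ne (∑ x', p x' y) 0 with h | h
    · rw [h, zero_mul]; exact hρ y
    · rw [mul_div_cancel₀ _ h]
  have htot := Finset.sum_le_sum fun x (_ : x ∈ Finset.univ) =>
    Finset.sum_le_sum fun y (_ : y ∈ Finset.univ) => key x y
  simp_rw [Finset.sum_add_distrib, ← Finset.mul_sum] at htot
  have hI : mutualInfo p =
      (∑ x, ∑ y, p x y * Real.log (p x y / ((∑ y', p x y') * (∑ x', p x' y)))) / Real.log 2 := by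
    simp_rw [mutualInfo, Real.logb, Finset.sum_div, mul_div_assoc]
  rw [hI, div_mul_eq_mul_div]
  exact div_le_div_of_nonneg_right (by linarith) hl.le

theorem channelInfo_nonneg {A Z : Type*} [Fintype A] [Fintype Z] (P : stdSimplex ℝ A)
    (W : Channel A Z) : 0 ≤ channelInfo P W := by
  refine mutualInfo_nonneg (fun a z => mul_nonneg (P.2.1 a) (W.nonneg a z)) ?_
  simp_rw [← Finset.mul_sum, W.sum_eq_one, mul_one]
  exact P.2.2

/-- In nats, `I(P, W)` is the sum of `P(a) W(z|a) log (W(z|a) / (PW)(z))`. -/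
theorem channelInfo_mul_log_two {A Z : Type*} [Fintype A] [Fintype Z] (P : stdSimplex ℝ A)
    (W : Channel A Z) : channelInfo P W * Real.log 2 =
      ∑ a, ∑ z, (P : A → ℝ) a * W.prob a z *
        Real.log (W.prob a z / ∑ b, (P : A → ℝ) b * W.prob b z) := by
  have hl : Real.log 2 ≠ 0 := (Real.log_pos one_lt_two).ne'
  simp only [channelInfo, mutualInfo, Finset.sum_mul _ _ (Real.log 2), Real.logb,
    mul_assoc _ _ (Real.log 2), div_mul_cancel₀ _ hl]
  refine Finset.sum_congr rfl fun a _ => Finset.sum_congr rfl fun z _ => ?_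
  rw [show ∑ y, (P : A → ℝ) a * W.prob a y = (P : A → ℝ) a by
    rw [← Finset.mul_sum, W.sum_eq_one, mul_one]]
  rcases eq_or_ne ((P : A → ℝ) a) 0 with h | h
  · simp [h]
  · rw [mul_div_mul_left _ _ h]

/-- The decomposition `I(P, W) = H(PW) - H(W|P)`, in nats. -/
theorem channelInfo_eq_entropy {A Z : Type*} [Fintype A] [Fintype Z] (P : stdSimplex ℝ A)
    (W : Channel A Z) : channelInfo P W * Real.log 2 =
      (∑ z, Real.negMulLog (∑ a, (P : A → ℝ) a * W.prob a z)) -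
        ∑ a, (P : A → ℝ) a * ∑ z, Real.negMulLog (W.prob a z) := by
  rw [channelInfo_mul_log_two]
  have key : ∀ a z, (P : A → ℝ) a * W.prob a z *
      Real.log (W.prob a z / ∑ b, (P : A → ℝ) b * W.prob b z) =
      -((P : A → ℝ) a * W.prob a z * Real.log (∑ b, (P : A → ℝ) b * W.prob b z)) -
        (P : A → ℝ) a * Real.negMulLog (W.prob a z) := by
    intro a z
    have h0 : 0 ≤ (P : A → ℝ) a * W.prob a z := mul_nonneg (P.2.1 a) (W.nonneg a z)
    rcases h0.eq_or_lt with h | h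
    · rw [← h, Real.negMulLog]
      linear_combination Real.log (W.prob a z) * h
    · have hW : W.prob a z ≠ 0 := fun h' => by simp [h'] at h
      have hq : 0 < ∑ b, (P : A → ℝ) b * W.prob b z :=
        h.trans_le (Finset.single_le_sum (f := fun b => (P : A → ℝ) b * W.prob b z)
          (fun b _ => mul_nonneg (P.2.1 b) (W.nonneg b z)) (Finset.mem_univ a))
      rw [Real.log_div hW hq.ne', Real.negMulLog]
      ring
  simp_rw [key, Finset.sum_sub_distrib, Finset.sum_neg_distrib]
  rw [Finset.sum_comm]
  simp_rw [← Finset.sum_mul, ← Finset.mul_sum, ← Finset.sum_neg_distrib, Real.negMulLog, neg_mul]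

theorem channelInfo_mul_log_two_le_card {A Z : Type*} [Fintype A] [Fintype Z] (P : stdSimplex ℝ A)
    (W : Channel A Z) : channelInfo P W * Real.log 2 ≤ Fintype.card Z := by
  rw [channelInfo_eq_entropy]
  have h1 : ∑ z, Real.negMulLog (∑ a, (P : A → ℝ) a * W.prob a z) ≤ ∑ _z : Z, (1 : ℝ) := by
    refine Finset.sum_le_sum fun z _ => ?_
    have h0 : 0 ≤ ∑ a, (P : A → ℝ) a * W.prob a z :=
      Finset.sum_nonneg fun a _ => mul_nonneg (P.2.1 a) (W.nonneg a z)
    have := Real.negMulLog_le_one_sub_self h0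
    linarith
  have h2 : 0 ≤ ∑ a, (P : A → ℝ) a * ∑ z, Real.negMulLog (W.prob a z) :=
    Finset.sum_nonneg fun a _ => mul_nonneg (P.2.1 a) <| Finset.sum_nonneg fun z _ =>
      Real.negMulLog_nonneg (W.nonneg a z) <| by
        rw [← W.sum_eq_one a]
        exact Finset.single_le_sum (f := fun z => W.prob a z) (fun z _ => W.nonneg a z)
          (Finset.mem_univ z)
  simp at h1
  linarith

theorem channelInfo_le_maxChannelInfo {A Z : Type*} [Fintype A] [Fintype Z]
    (P : stdSimplex ℝ A) (W : Channel A Z) : channelInfo P W ≤ maxChannelInfo W := by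
  refine le_ciSup (f := fun P => channelInfo P W) ⟨Fintype.card Z / Real.log 2, ?_⟩ P
  rintro _ ⟨Q, rfl⟩
  rw [le_div_iff₀ (Real.log_pos one_lt_two)]
  exact channelInfo_mul_log_two_le_card Q W

theorem maxChannelInfo_nonneg {A Z : Type*} [Fintype A] [Fintype Z] (W : Channel A Z) :
    0 ≤ maxChannelInfo W :=
  Real.iSup_nonneg fun P => channelInfo_nonneg P W

/-! ### Continuity of mutual information in the input distribution -/

theorem negMulLog_le_two_mul_sqrt {u : ℝ} (hu : 0 ≤ u) : Real.negMulLog u ≤ 2 * √u := by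
  rcases hu.eq_or_lt with rfl | h
  · simp
  · have hs : 0 < √u := Real.sqrt_pos.2 h
    have h1 := Real.one_sub_inv_le_log_of_pos hs
    rw [Real.log_sqrt hu] at h1
    have h2 : u * (√u)⁻¹ = √u := by
      rw [← div_eq_mul_inv]; exact Real.div_sqrt
    have h3 := mul_le_mul_of_nonneg_left h1 hu
    rw [mul_sub, h2] at h3
    rw [Real.negMulLog]
    nlinarith

theorem negMulLog_sub_le {x y h : ℝ} (hx : 0 ≤ x) (hy : 0 ≤ y) (hy1 : y ≤ 1) (hxy : |x - y| ≤ h) :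
    Real.negMulLog x - Real.negMulLog y ≤ 2 * √h + h := by
  have hh : 0 ≤ h := (abs_nonneg _).trans hxy
  have hsh := Real.sqrt_nonneg h
  obtain ⟨hl, hu⟩ := abs_le.1 hxy
  rcases hy.eq_or_lt with rfl | hy0
  · have := negMulLog_le_two_mul_sqrt hx
    have := Real.sqrt_le_sqrt (show x ≤ h by linarith)
    simp
    linarith
  rcases hx.eq_or_lt with rfl | hx0
  · have := Real.negMulLog_nonneg hy hy1
    simp
    linarith
  rcases le_total y x with hle | hle
  · -- subadditivity: `-log` is decreasing
    have h1 : Real.negMulLog x ≤ Real.negMulLog y + Real.negMulLog (x - y) := by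
      have e1 : Real.log y ≤ Real.log x := Real.log_le_log hy0 hle
      have e2 : (x - y) * Real.log (x - y) ≤ (x - y) * Real.log x := by
        rcases hle.eq_or_lt with rfl | hlt
        · simp
        · exact mul_le_mul_of_nonneg_left (Real.log_le_log (by linarith) (by linarith))
            (by linarith)
      simp only [Real.negMulLog]
      nlinarith
    have h2 := negMulLog_le_two_mul_sqrt (sub_nonneg.2 hle)
    have h3 := Real.sqrt_le_sqrt hu
    linarith
  · have h1 := Real.log_le_sub_one_of_pos (div_pos hy0 hx0)
    rw [Real.log_div hy0.ne' hx0.ne'] at h1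
    have h2 := mul_le_mul_of_nonneg_left h1 hx
    have h3 : x * (y / x - 1) = y - x := by field_simp
    have h4 : Real.log y ≤ 0 := Real.log_nonpos hy hy1
    rw [h3] at h2
    simp only [Real.negMulLog]
    nlinarith

/-- A modulus of continuity of `P ↦ I(P, W)`, uniform over all channels `W` with input alphabet
of size `a` and output alphabet of size `z`. The summand `δ` only ensures positivity. -/
noncomputable def infoModulus (δ : ℝ) (a z : ℕ) : ℝ :=
  (z * (2 * √(a * δ) + a * δ) + a * δ * z) / Real.log 2 + δ

theorem infoModulus_pos {δ : ℝ} (a z : ℕ) (hδ : 0 < δ) : 0 < infoModulus δ a z := by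
  have hl : 0 < Real.log 2 := Real.log_pos one_lt_two
  unfold infoModulus
  positivity

theorem tendsto_infoModulus (a z : ℕ) :
    Tendsto (fun δ => infoModulus δ a z) (𝓝[>] 0) (𝓝 0) := by
  have h : Continuous fun δ => infoModulus δ a z := by
    unfold infoModulus
    fun_prop
  have h0 := (h.tendsto 0).mono_left (nhdsWithin_le_nhds (s := Set.Ioi 0))
  simpa [infoModulus] using h0

theorem channelInfo_le_add_infoModulus {A Z : Type*} [Fintype A] [Fintype Z]
    (P P' : stdSimplex ℝ A) (W : Channel A Z) {δ : ℝ} (hδ : 0 < δ)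
    (hPP : ∀ a, |(P' : A → ℝ) a - (P : A → ℝ) a| ≤ δ) :
    channelInfo P' W ≤ channelInfo P W + infoModulus δ (Fintype.card A) (Fintype.card Z) := by
  have hl : 0 < Real.log 2 := Real.log_pos one_lt_two
  have hW1 : ∀ a z, W.prob a z ≤ 1 := fun a z => by
    rw [← W.sum_eq_one a]
    exact Finset.single_le_sum (f := fun z => W.prob a z) (fun z _ => W.nonneg a z)
      (Finset.mem_univ z)
  have hq : ∀ z, Real.negMulLog (∑ a, (P' : A → ℝ) a * W.prob a z) -
      Real.negMulLog (∑ a, (P : A → ℝ) a * W.prob a z) ≤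
      2 * √(Fintype.card A * δ) + Fintype.card A * δ := by
    intro z
    refine negMulLog_sub_le
      (Finset.sum_nonneg fun a _ => mul_nonneg (P'.2.1 a) (W.nonneg a z))
      (Finset.sum_nonneg fun a _ => mul_nonneg (P.2.1 a) (W.nonneg a z)) ?_ ?_
    · rw [← P.2.2]
      exact Finset.sum_le_sum fun a _ => mul_le_of_le_one_right (P.2.1 a) (hW1 a z)
    · rw [← Finset.sum_sub_distrib]
      refine (Finset.abs_sum_le_sum_abs _ _).trans ?_
      refine (Finset.sum_le_sum (g := fun _ => δ) fun a _ => ?_).trans (by simp)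
      rw [← sub_mul, abs_mul, abs_of_nonneg (W.nonneg a z)]
      exact (mul_le_of_le_one_right (abs_nonneg _) (hW1 a z)).trans (hPP a)
  have hcond : ∀ a, ((P : A → ℝ) a - (P' : A → ℝ) a) * ∑ z, Real.negMulLog (W.prob a z) ≤
      δ * Fintype.card Z := by
    intro a
    have h0 : 0 ≤ ∑ z, Real.negMulLog (W.prob a z) :=
      Finset.sum_nonneg fun z _ => Real.negMulLog_nonneg (W.nonneg a z) (hW1 a z)
    have h1 : ∑ z, Real.negMulLog (W.prob a z) ≤ Fintype.card Z := by
      refine (Finset.sum_le_sum (g := fun _ => (1 : ℝ)) fun z _ => ?_).trans (by simp)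
      have := Real.negMulLog_le_one_sub_self (W.nonneg a z)
      have := W.nonneg a z
      linarith
    have h2 : (P : A → ℝ) a - (P' : A → ℝ) a ≤ δ := by
      have := (abs_le.1 (hPP a)).1; linarith
    exact mul_le_mul h2 h1 h0 hδ.le
  have e1 := Finset.sum_le_sum fun z (_ : z ∈ Finset.univ) => hq z
  have e2 := Finset.sum_le_sum fun a (_ : a ∈ Finset.univ) => hcond a
  simp only [Finset.sum_sub_distrib, sub_mul, Finset.sum_const, Finset.card_univ,
    nsmul_eq_mul] at e1 e2
  have h1 := channelInfo_eq_entropy P W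
  have h2 := channelInfo_eq_entropy P' W
  refine le_of_mul_le_mul_right ?_ hl
  rw [add_mul, infoModulus, add_mul, div_mul_cancel₀ _ hl.ne']
  have : 0 ≤ δ * Real.log 2 := by positivity
  linarith

/-! ### The spectral gap of a biregular irreducible function -/

/-- If `1` is a fixed vector of a symmetric matrix whose second-largest eigenvalue modulus is
less than `1`, then this modulus bounds the quadratic form on the orthogonal complement of `1`. -/
theorem dotProduct_mulVec_le_secondEigenvalueModulus {X : Type*} [Fintype X] [DecidableEq X]
    {M : Matrix X X ℝ} (hM : M.IsHermitian) (hlt : secondEigenvalueModulus M hM < 1)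
    (h1 : M.mulVec 1 = 1) {v : X → ℝ} (hv : ∑ x, v x = 0) :
    v ⬝ᵥ M.mulVec v ≤ secondEigenvalueModulus M hM * (v ⬝ᵥ v) := by
  by_cases hc : 1 < Fintype.card X
  swap
  · have : Subsingleton X := Fintype.card_le_one_iff_subsingleton.1 (not_lt.1 hc)
    have hv0 : v = 0 := by
      funext x
      rwa [Fintype.sum_subsingleton _ x] at hv
    simp [hv0]
  set lam := secondEigenvalueModulus M hM with hlam
  let e : Fin (Fintype.card X) ≃ X := Fintype.equivOfCardEq (Fintype.card_fin _)
  let i₀ : X := e ⟨0, by omega⟩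
  have hmu : ∀ i, i ≠ i₀ → |hM.eigenvalues i| ≤ lam := by
    intro i hi
    have hk : e.symm i ≠ ⟨0, by omega⟩ := fun h => hi ((Equiv.symm_apply_eq e).1 h)
    have hk1 : 1 ≤ (e.symm i : ℕ) := by
      rcases Nat.eq_zero_or_pos (e.symm i : ℕ) with h | h
      · exact absurd (Fin.ext h) hk
      · exact h
    have hup : hM.eigenvalues₀ (e.symm i) ≤ hM.eigenvalues₀ ⟨1, hc⟩ :=
      hM.eigenvalues₀_antitone hk1
    have hlo : hM.eigenvalues₀ ⟨Fintype.card X - 1, by omega⟩ ≤ hM.eigenvalues₀ (e.symm i) :=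
      hM.eigenvalues₀_antitone (Nat.le_sub_one_of_lt (e.symm i).2)
    have hdef : lam = max |hM.eigenvalues₀ ⟨1, hc⟩|
        |hM.eigenvalues₀ ⟨Fintype.card X - 1, by omega⟩| := by
      rw [hlam, secondEigenvalueModulus, dif_pos hc]
    change |hM.eigenvalues₀ (e.symm i)| ≤ lam
    rw [hdef, max_comm]
    exact abs_le_max_abs_abs hlo hup
  let c : (X → ℝ) → X → ℝ := fun w i => (hM.eigenvectorBasis i : X → ℝ) ⬝ᵥ w
  have parseval : ∀ u w, u ⬝ᵥ w = ∑ i, c u i * c w i := by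
    intro u w
    have h := hM.eigenvectorBasis.sum_inner_mul_inner (WithLp.toLp 2 u) (WithLp.toLp 2 w)
    simp only [EuclideanSpace.inner_eq_star_dotProduct, star_trivial] at h
    rw [dotProduct_comm, ← h]
    refine Finset.sum_congr rfl fun i _ => ?_
    simp only [c]
    rw [dotProduct_comm w]
  have hcM : ∀ w i, c (M.mulVec w) i = hM.eigenvalues i * c w i := by
    intro w i
    have hT : M.transpose = M := by
      have := hM.eq
      rwa [Matrix.conjTranspose_eq_transpose_of_trivial] at this
    simp only [c]
    rw [Matrix.dotProduct_mulVec, ← Matrix.mulVec_transpose, hT, hM.mulVec_eigenvectorBasis,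
      smul_dotProduct, smul_eq_mul]
  -- the fixed vector `1` is a multiple of the first eigenvector
  have hone : ∀ i, i ≠ i₀ → c 1 i = 0 := by
    intro i hi
    have h := hcM 1 i
    rw [h1] at h
    have hne : hM.eigenvalues i ≠ 1 := fun h' => by
      have := hmu i hi
      rw [h', abs_one] at this
      linarith
    have h' : (hM.eigenvalues i - 1) * c 1 i = 0 := by linear_combination -h
    exact (mul_eq_zero.1 h').resolve_left (sub_ne_zero.2 hne)
  have hsingle : ∀ w, (1 : X → ℝ) ⬝ᵥ w = c 1 i₀ * c w i₀ := by
    intro w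
    rw [parseval]
    exact Finset.sum_eq_single _ (fun i _ hi => by rw [hone i hi, zero_mul]) (by simp)
  have hv0 : c v i₀ = 0 := by
    have h2 := hsingle v
    rw [one_dotProduct, hv] at h2
    have h3 := hsingle 1
    rw [one_dotProduct] at h3
    rcases mul_eq_zero.1 h2.symm with h | h
    · rw [h, zero_mul] at h3
      simp at h3
      omega
    · exact h
  rw [parseval, parseval, Finset.mul_sum]
  refine Finset.sum_le_sum fun i _ => ?_
  rw [hcM]
  rcases eq_or_ne i i₀ with rfl | hi
  · simp [hv0]
  · have := (le_abs_self _).trans (hmu i hi)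
    nlinarith [mul_self_nonneg (c v i)]

theorem secondEigenvalueModulus_nonneg {X : Type*} [Fintype X] [DecidableEq X]
    {M : Matrix X X ℝ} (hM : M.IsHermitian) : 0 ≤ secondEigenvalueModulus M hM := by
  unfold secondEigenvalueModulus
  split_ifs
  · exact (abs_nonneg _).trans (le_max_left _ _)
  · exact le_rfl

namespace BRIFunction

variable {S X N : Type*} [Fintype S] [Fintype X] [DecidableEq X] [DecidableEq N]

theorem lambda2_nonneg (f : BRIFunction S X N) (m : N) : 0 ≤ f.lambda2 m :=
  secondEigenvalueModulus_nonneg _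

/-- The indicator of `f(s, x) = m`. -/
def ind (f : BRIFunction S X N) (m : N) (s : S) (x : X) : ℝ := if f.toFun s x = m then 1 else 0

theorem randInverse_prob (f : BRIFunction S X N) (m : f.regSet) (s : S) (x : X) :
    f.randInverse.prob (s, m) x = f.ind m s x / f.dS := by
  simp only [randInverse, ind]; split_ifs <;> simp

theorem sum_ind_right (f : BRIFunction S X N) (m : f.regSet) (s : S) :
    ∑ x, f.ind m s x = f.dS := by
  rw [← f.S_regular m m.2 s]; simp [ind]

theorem sum_ind_left (f : BRIFunction S X N) (m : f.regSet) (x : X) :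
    ∑ s, f.ind m s x = f.dX := by
  rw [← f.X_regular m m.2 x]; simp [ind]

theorem card_mul_dS (f : BRIFunction S X N) (m : f.regSet) :
    (Fintype.card S : ℝ) * f.dS = Fintype.card X * f.dX := by
  have h : ∑ s, ∑ x, f.ind m s x = ∑ x, ∑ s, f.ind m s x := Finset.sum_comm
  simpa [f.sum_ind_right, f.sum_ind_left] using h

theorem transitionMatrix_apply (f : BRIFunction S X N) (m : N) (x x' : X) :
    transitionMatrix f.toFun f.dS f.dX m x x' =
      (∑ s, f.ind m s x * f.ind m s x') / (f.dS * f.dX) := by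
  simp only [transitionMatrix, Matrix.of_apply, ind, ← ite_and, mul_ite, mul_one, mul_zero]
  congr 1
  rw [Finset.card_filter]
  push_cast
  refine Finset.sum_congr rfl fun s _ => ?_
  simp only [and_comm]

theorem transitionMatrix_mulVec_one (f : BRIFunction S X N) (m : f.regSet) :
    (transitionMatrix f.toFun f.dS f.dX m).mulVec 1 = 1 := by
  have hS : (f.dS : ℝ) ≠ 0 := by exact_mod_cast f.dS_pos.ne'
  have hX : (f.dX : ℝ) ≠ 0 := by exact_mod_cast f.dX_pos.ne'
  funext x
  rw [Matrix.mulVec, dotProduct_one]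
  simp_rw [transitionMatrix_apply, ← Finset.sum_div]
  rw [Finset.sum_comm]
  simp_rw [← Finset.mul_sum, f.sum_ind_right, ← Finset.sum_mul, f.sum_ind_left]
  rw [mul_comm, div_self (mul_ne_zero hS hX), Pi.one_apply]

theorem sum_sq_sum_ind_le (f : BRIFunction S X N) (m : f.regSet) {v : X → ℝ}
    (hv : ∑ x, v x = 0) :
    ∑ s, (∑ x, f.ind m s x * v x) ^ 2 ≤ f.dS * f.dX * (f.lambda2 m * ∑ x, v x ^ 2) := by
  have hS : (0 : ℝ) < f.dS := by exact_mod_cast f.dS_pos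
  have hX : (0 : ℝ) < f.dX := by exact_mod_cast f.dX_pos
  have h := dotProduct_mulVec_le_secondEigenvalueModulus
    (transitionMatrix_isHermitian f.toFun f.dS f.dX m) (f.irreducible m m.2)
    (f.transitionMatrix_mulVec_one m) hv
  have e1 : ∑ s, (∑ x, f.ind m s x * v x) ^ 2 =
      f.dS * f.dX * (v ⬝ᵥ (transitionMatrix f.toFun f.dS f.dX m).mulVec v) := by
    simp_rw [dotProduct, Matrix.mulVec, dotProduct, transitionMatrix_apply, sq,
      Finset.sum_mul_sum, Finset.mul_sum]
    rw [Finset.sum_comm]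
    refine Finset.sum_congr rfl fun x _ => ?_
    rw [Finset.sum_comm]
    refine Finset.sum_congr rfl fun x' _ => ?_
    rw [show (f.dS * f.dX : ℝ) * (v x * ((∑ s, f.ind m s x * f.ind m s x') / (f.dS * f.dX) * v x'))
      = (∑ s, f.ind m s x * f.ind m s x') * (v x * v x') by field_simp, Finset.sum_mul]
    exact Finset.sum_congr rfl fun s _ => by ring
  have e2 : ∑ x, v x ^ 2 = v ⬝ᵥ v := by simp [dotProduct, sq]
  rw [e1, e2]
  exact mul_le_mul_of_nonneg_left h (by positivity)

theorem card_pos (f : BRIFunction S X N) (m : f.regSet) :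
    (0 : ℝ) < Fintype.card S ∧ (0 : ℝ) < Fintype.card X := by
  obtain ⟨s, x, -⟩ := f.surjective m
  exact ⟨by exact_mod_cast Fintype.card_pos_iff.2 ⟨s⟩, by exact_mod_cast Fintype.card_pos_iff.2 ⟨x⟩⟩

/-- For a random seed, the average of `w` over `f_s⁻¹(m)` has mean `∑ w / |X|`, and its variance
is controlled by `λ₂(f, m)`. -/
theorem sum_sq_randInverse_sub_le (f : BRIFunction S X N) (m : f.regSet) (w : X → ℝ) :
    ∑ s, (∑ x, f.randInverse.prob (s, m) x * w x - (∑ x, w x) / Fintype.card X) ^ 2 ≤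
      Fintype.card S * (f.lambda2 m * ((∑ x, w x ^ 2) / Fintype.card X)) := by
  have hS : (0 : ℝ) < f.dS := by exact_mod_cast f.dS_pos
  obtain ⟨-, hX⟩ := f.card_pos m
  set μ := (∑ x, w x) / Fintype.card X with hμ
  have hμ' : ∑ x, w x = Fintype.card X * μ := by rw [hμ]; field_simp
  have hv : ∑ x, (w x - μ) = 0 := by
    rw [Finset.sum_sub_distrib, hμ']; simp
  have hv2 : ∑ x, (w x - μ) ^ 2 ≤ ∑ x, w x ^ 2 := by
    have : ∑ x, (w x - μ) ^ 2 = ∑ x, w x ^ 2 - Fintype.card X * μ ^ 2 := by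
      simp_rw [sub_sq, Finset.sum_add_distrib, Finset.sum_sub_distrib, ← Finset.sum_mul,
        ← Finset.mul_sum]
      rw [hμ']; simp; ring
    have : 0 ≤ Fintype.card X * μ ^ 2 := by positivity
    linarith
  have e1 : ∀ s, ∑ x, f.randInverse.prob (s, m) x * w x - μ =
      (∑ x, f.ind m s x * (w x - μ)) / f.dS := by
    intro s
    simp_rw [randInverse_prob, mul_sub, Finset.sum_sub_distrib, ← Finset.sum_mul, f.sum_ind_right,
      sub_div, Finset.sum_div]
    rw [mul_div_cancel_left₀ _ hS.ne']
    congr 1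
    exact Finset.sum_congr rfl fun x _ => by ring
  simp_rw [e1, div_pow, ← Finset.sum_div]
  rw [div_le_iff₀ (by positivity)]
  refine (f.sum_sq_sum_ind_le m hv).trans ?_
  have hc := f.card_mul_dS m
  calc (f.dS : ℝ) * f.dX * (f.lambda2 m * ∑ x, (w x - μ) ^ 2)
      ≤ f.dS * f.dX * (f.lambda2 m * ∑ x, w x ^ 2) :=
        mul_le_mul_of_nonneg_left
          (mul_le_mul_of_nonneg_left hv2 (f.lambda2_nonneg m)) (by positivity)
    _ = _ := by
        field_simp
        linear_combination (-(f.lambda2 m * ∑ x, w x ^ 2)) * hc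

theorem sum_abs_randInverse_sub_le (f : BRIFunction S X N) (m : f.regSet) (w : X → ℝ) :
    ∑ s, |∑ x, f.randInverse.prob (s, m) x * w x - (∑ x, w x) / Fintype.card X| ≤
      Fintype.card S * √(f.lambda2 m * ((∑ x, w x ^ 2) / Fintype.card X)) := by
  obtain ⟨hS, hX⟩ := f.card_pos m
  have h := sq_sum_le_card_mul_sum_sq (s := (Finset.univ : Finset S))
    (f := fun s => |∑ x, f.randInverse.prob (s, m) x * w x - (∑ x, w x) / Fintype.card X|)
  simp only [sq_abs, Finset.card_univ] at h
  refine (Real.le_sqrt_of_sq_le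
    (h.trans (mul_le_mul_of_nonneg_left (f.sum_sq_randInverse_sub_le m w) hS.le))).trans_eq ?_
  rw [← mul_assoc, Real.sqrt_mul (by positivity), Real.sqrt_mul_self hS.le]

/-- The contribution to the `ℓ¹` distance of a part `W₁` of a channel that is dominated by
`K · q`, where `q` is a measure of mass at most `B`. -/
theorem sum_sum_abs_le_of_dominated {Z : Type*} [Fintype Z] (f : BRIFunction S X N)
    (m : f.regSet) {W₁ : X → Z → ℝ} {q : Z → ℝ} {K B : ℝ} (hW : ∀ x z, 0 ≤ W₁ x z)
    (hq : ∀ z, 0 ≤ q z) (hK : 0 ≤ K) (hdom : ∀ x z, W₁ x z ≤ K * q z)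
    (hW1 : ∀ x, ∑ z, W₁ x z ≤ 1) (hB : ∑ z, q z ≤ B) :
    ∑ z, ∑ s, |∑ x, f.randInverse.prob (s, m) x * W₁ x z - (∑ x, W₁ x z) / Fintype.card X| ≤
      Fintype.card S * √(f.lambda2 m * K * B) := by
  obtain ⟨hS, hX⟩ := f.card_pos m
  have hlam := f.lambda2_nonneg m
  set Q : Z → ℝ := fun z => (∑ x, W₁ x z) / Fintype.card X with hQ
  have hQ0 : ∀ z, 0 ≤ Q z := fun z => div_nonneg (Finset.sum_nonneg fun x _ => hW x z) hX.le
  have hQ1 : ∑ z, Q z ≤ 1 := by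
    simp only [hQ]
    rw [← Finset.sum_div, Finset.sum_comm, div_le_one hX]
    exact (Finset.sum_le_sum fun x _ => hW1 x).trans (by simp)
  have hB0 : 0 ≤ B := (Finset.sum_nonneg fun z _ => hq z).trans hB
  have key : ∀ z, √(f.lambda2 m * ((∑ x, W₁ x z ^ 2) / Fintype.card X)) ≤
      √(f.lambda2 m * K) * (√(q z) * √(Q z)) := by
    intro z
    rw [← Real.sqrt_mul (hq z), ← Real.sqrt_mul (by positivity)]
    refine Real.sqrt_le_sqrt ?_
    rw [mul_assoc (f.lambda2 m)]
    refine mul_le_mul_of_nonneg_left ?_ hlam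
    simp only [hQ]
    rw [← mul_assoc, ← mul_div_assoc]
    refine div_le_div_of_nonneg_right ?_ hX.le
    rw [Finset.mul_sum]
    refine Finset.sum_le_sum fun x _ => ?_
    rw [sq]
    exact mul_le_mul_of_nonneg_right (hdom x z) (hW x z)
  calc _ ≤ ∑ z, Fintype.card S * (√(f.lambda2 m * K) * (√(q z) * √(Q z))) :=
        Finset.sum_le_sum fun z _ => (f.sum_abs_randInverse_sub_le m fun x => W₁ x z).trans
          (mul_le_mul_of_nonneg_left (key z) hS.le)
    _ = Fintype.card S * (√(f.lambda2 m * K) * ∑ z, √(q z) * √(Q z)) := by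
        simp_rw [← Finset.mul_sum]
    _ ≤ Fintype.card S * (√(f.lambda2 m * K) * √B) := by
        gcongr
        refine (Real.sum_sqrt_mul_sqrt_le _ (fun z => hq z) (fun z => hQ0 z)).trans ?_
        have h1 := Real.sqrt_le_sqrt hB
        have h2 : √(∑ z, Q z) ≤ 1 := Real.sqrt_le_one.2 hQ1
        exact (mul_le_mul h1 h2 (Real.sqrt_nonneg _) (Real.sqrt_nonneg _)).trans_eq (mul_one _)
    _ = _ := by rw [← Real.sqrt_mul (by positivity)]

theorem sum_sum_abs_le_of_small {Z : Type*} [Fintype Z] (f : BRIFunction S X N)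
    (m : f.regSet) {W₂ : X → Z → ℝ} {β : ℝ} (hW : ∀ x z, 0 ≤ W₂ x z)
    (hβ : ∀ x, ∑ z, W₂ x z ≤ β) :
    ∑ z, ∑ s, |∑ x, f.randInverse.prob (s, m) x * W₂ x z - (∑ x, W₂ x z) / Fintype.card X| ≤
      Fintype.card S * (2 * β) := by
  obtain ⟨hS, hX⟩ := f.card_pos m
  have key : ∀ s, ∑ z, |∑ x, f.randInverse.prob (s, m) x * W₂ x z -
      (∑ x, W₂ x z) / Fintype.card X| ≤ 2 * β := by
    intro s
    calc _ ≤ ∑ z, (∑ x, f.randInverse.prob (s, m) x * W₂ x z +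
          (∑ x, W₂ x z) / Fintype.card X) := by
          refine Finset.sum_le_sum fun z _ => (abs_sub _ _).trans_eq ?_
          rw [abs_of_nonneg, abs_of_nonneg]
          · exact div_nonneg (Finset.sum_nonneg fun x _ => hW x z) hX.le
          · exact Finset.sum_nonneg fun x _ => mul_nonneg (f.randInverse.nonneg _ x) (hW x z)
      _ = ∑ x, f.randInverse.prob (s, m) x * ∑ z, W₂ x z +
          (∑ x, ∑ z, W₂ x z) / Fintype.card X := by
          rw [Finset.sum_add_distrib, Finset.sum_comm, ← Finset.sum_div,
            Finset.sum_comm (f := fun z x => W₂ x z)]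
          simp_rw [Finset.mul_sum]
      _ ≤ ∑ x, f.randInverse.prob (s, m) x * β + (∑ _x : X, β) / Fintype.card X := by
          refine add_le_add (Finset.sum_le_sum fun x _ =>
            mul_le_mul_of_nonneg_left (hβ x) (f.randInverse.nonneg _ x)) ?_
          exact div_le_div_of_nonneg_right (Finset.sum_le_sum fun x _ => hβ x) hX.le
      _ = 2 * β := by
          rw [← Finset.sum_mul, f.randInverse.sum_eq_one]
          simp
          field_simp
          ring
  rw [Finset.sum_comm]
  exact (Finset.sum_le_sum fun s _ => key s).trans (by simp)

end BRIFunction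

/-! ### Semantic security leakage of a modular scheme -/

theorem Channel.comp_assoc_prob {V X A Z : Type*} [Fintype X] [Fintype A] [Fintype Z]
    (R : Channel V X) (E : Channel X A) (U : Channel A Z) (v : V) (z : Z) :
    ((R.comp E).comp U).prob v z = ∑ x, R.prob v x * (E.comp U).prob x z := by
  simp only [Channel.comp, Finset.sum_mul, Finset.mul_sum]
  rw [Finset.sum_comm]
  exact Finset.sum_congr rfl fun _ _ => Finset.sum_congr rfl fun _ _ => by ring

theorem sum_joint_eq {S N A Y Z : Type*} [Fintype S] [Fintype A] [Fintype Z] {M : Finset N}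
    (C : SeededWiretapCode S M A Y) (U : Channel A Z)
    (P : stdSimplex ℝ M) (hS : (Fintype.card S : ℝ) ≠ 0) (m : M) :
    ∑ q : Z × S, (P : M → ℝ) m * (1 / (Fintype.card S : ℝ)) * (C.enc.comp U).prob (q.2, m) q.1 =
      (P : M → ℝ) m := by
  rw [Fintype.sum_prod_type_right]
  simp_rw [← Finset.mul_sum, (C.enc.comp U).sum_eq_one]
  simp
  field_simp

section Leakage

variable {S X N A Y Z : Type*} [Fintype S] [Fintype X] [DecidableEq X] [DecidableEq N]
  [Fintype A] [Fintype Z]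

theorem semLeakage_nonneg (f : BRIFunction S X N) (C : ECCode X A Y) (U : Channel A Z) :
    0 ≤ (modularBRI f C).semLeakage U := by
  refine Real.iSup_nonneg fun P => mutualInfo_nonneg (fun m q => ?_) ?_
  · exact mul_nonneg (mul_nonneg (P.2.1 m) (by positivity)) (Channel.nonneg _ _ _)
  · obtain ⟨m⟩ : Nonempty f.regSet := by
      by_contra h
      rw [not_nonempty_iff] at h
      simpa using P.2.2
    simp_rw [sum_joint_eq _ U P (f.card_pos m).1.ne']
    exact P.2.2

/-- Conditionally on every message, the observation has the same distribution `Q`, the output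
distribution for a uniform input in `X`. Hence the leakage is controlled by the `ℓ¹` distance of
the joint distribution of observation and seed from `Q × uniform`. -/
theorem semLeakage_le_of_l1_le (f : BRIFunction S X N) (C : ECCode X A Y) (U : Channel A Z)
    {D : ℝ} (hD : 0 ≤ D)
    (h : ∀ m : f.regSet, ∑ z, ∑ s, |∑ x, f.randInverse.prob (s, m) x * (C.enc.comp U).prob x z -
      (∑ x, (C.enc.comp U).prob x z) / Fintype.card X| ≤ Fintype.card S * D) :
    (modularBRI f C).semLeakage U ≤
      (1 + Real.log (Fintype.card X)) / Real.log 2 * D := by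
  have hl : 0 < Real.log 2 := Real.log_pos one_lt_two
  refine Real.iSup_le (fun P => ?_) (mul_nonneg (div_nonneg
    (add_nonneg zero_le_one (Real.log_natCast_nonneg _)) hl.le) hD)
  obtain ⟨m₀⟩ : Nonempty f.regSet := by
    by_contra h
    rw [not_nonempty_iff] at h
    simpa using P.2.2
  obtain ⟨hS, hX⟩ := f.card_pos m₀
  have hX1 : (1 : ℝ) ≤ Fintype.card X := by
    exact_mod_cast Nat.one_le_iff_ne_zero.2 (fun h => by simp [h] at hX)
  have hmarg := fun m => sum_joint_eq (modularBRI f C) U P hS.ne' m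
  set W := C.enc.comp U
  have hI := mutualInfo_le_l1
    (p := fun (m : f.regSet) (q : Z × S) => (P : f.regSet → ℝ) m * (1 / (Fintype.card S : ℝ)) *
      ((modularBRI f C).enc.comp U).prob (q.2, m) q.1)
    (ρ := fun q => (∑ x, W.prob x q.1) / Fintype.card X * (1 / (Fintype.card S : ℝ))) hX1
    (fun m q => mul_nonneg (mul_nonneg (P.2.1 m) (by positivity)) (Channel.nonneg _ _ _))
    (by simp_rw [hmarg]; exact P.2.2)
    (fun q => mul_nonneg (div_nonneg (Finset.sum_nonneg fun x _ => W.nonneg x q.1) hX.le)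
      (by positivity))
    (by
      rw [Fintype.sum_prod_type_right]
      have hW : ∑ z, ∑ x, W.prob x z = Fintype.card X := by
        rw [Finset.sum_comm]
        simp [W.sum_eq_one]
      simp_rw [← Finset.sum_mul, ← Finset.sum_div, hW]
      simp
      field_simp)
    (by
      intro m q
      rw [hmarg]
      have hr : ((modularBRI f C).enc.comp U).prob (q.2, m) q.1 ≤ ∑ x, W.prob x q.1 := by
        simp only [modularBRI]
        rw [Channel.comp_assoc_prob]
        refine Finset.sum_le_sum fun x _ => mul_le_of_le_one_left (W.nonneg x _) ?_
        rw [← f.randInverse.sum_eq_one (q.2, m)]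
        exact Finset.single_le_sum (f := fun x => f.randInverse.prob (q.2, m) x)
          (fun x _ => f.randInverse.nonneg _ x) (Finset.mem_univ x)
      have h0 : 0 ≤ (P : f.regSet → ℝ) m * (1 / (Fintype.card S : ℝ)) :=
        mul_nonneg (P.2.1 m) (by positivity)
      refine (mul_le_mul_of_nonneg_left hr h0).trans_eq ?_
      field_simp)
  refine hI.trans (mul_le_mul_of_nonneg_left ?_ (div_nonneg
    (add_nonneg zero_le_one (Real.log_nonneg hX1)) hl.le))
  have key : ∀ m, ∑ q : Z × S, |(P : f.regSet → ℝ) m * (1 / (Fintype.card S : ℝ)) *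
      ((modularBRI f C).enc.comp U).prob (q.2, m) q.1 - (P : f.regSet → ℝ) m *
        ((∑ x, W.prob x q.1) / Fintype.card X * (1 / (Fintype.card S : ℝ)))| ≤
      (P : f.regSet → ℝ) m * D := by
    intro m
    have h0 : 0 ≤ (P : f.regSet → ℝ) m * (1 / (Fintype.card S : ℝ)) :=
      mul_nonneg (P.2.1 m) (by positivity)
    have e : ∀ q : Z × S, |(P : f.regSet → ℝ) m * (1 / (Fintype.card S : ℝ)) *
      ((modularBRI f C).enc.comp U).prob (q.2, m) q.1 - (P : f.regSet → ℝ) m *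
        ((∑ x, W.prob x q.1) / Fintype.card X * (1 / (Fintype.card S : ℝ)))| =
        (P : f.regSet → ℝ) m * (1 / (Fintype.card S : ℝ)) *
          |∑ x, f.randInverse.prob (q.2, m) x * W.prob x q.1 -
            (∑ x, W.prob x q.1) / Fintype.card X| := by
      intro q
      rw [← abs_of_nonneg h0, ← abs_mul, abs_of_nonneg h0, mul_sub]
      simp only [modularBRI]
      rw [Channel.comp_assoc_prob]
      congr 2
      ring
    simp_rw [e, ← Finset.mul_sum]
    rw [Fintype.sum_prod_type]
    refine (mul_le_mul_of_nonneg_left (h m) h0).trans_eq ?_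
    field_simp
  simp_rw [hmarg]
  refine (Finset.sum_le_sum fun m _ => key m).trans_eq ?_
  rw [← Finset.sum_mul]
  rw [show ∑ m, (P : f.regSet → ℝ) m = 1 from P.2.2, one_mul]

/-- One-shot bound on the leakage. The measure `q` has mass at most `B`, and `β` bounds the
probability, for every channel input the code uses, that the likelihood `U(z|a)` exceeds
`K · q(z)`. -/
theorem semLeakage_le_of_truncation (f : BRIFunction S X N) (C : ECCode X A Y) (U : Channel A Z)
    {q : Z → ℝ} {K B β Λ : ℝ} (hq : ∀ z, 0 ≤ q z) (hK : 0 ≤ K) (hB : ∑ z, q z ≤ B) (hβ0 : 0 ≤ β)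
    (hβ : ∀ x a, C.enc.prob x a ≠ 0 → ∑ z, (if K * q z < U.prob a z then U.prob a z else 0) ≤ β)
    (hΛ : ∀ m ∈ f.regSet, f.lambda2 m ≤ Λ) :
    (modularBRI f C).semLeakage U ≤
      (1 + Real.log (Fintype.card X)) / Real.log 2 * (√(Λ * K * B) + 2 * β) := by
  have hB0 : 0 ≤ B := (Finset.sum_nonneg fun z _ => hq z).trans hB
  refine semLeakage_le_of_l1_le f C U (by positivity) fun m => ?_
  let W₁ : X → Z → ℝ := fun x z => ∑ a, C.enc.prob x a *
    (if K * q z < U.prob a z then 0 else U.prob a z)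
  let W₂ : X → Z → ℝ := fun x z => ∑ a, C.enc.prob x a *
    (if K * q z < U.prob a z then U.prob a z else 0)
  have hsplit : ∀ x z, (C.enc.comp U).prob x z = W₁ x z + W₂ x z := by
    intro x z
    simp only [Channel.comp, W₁, W₂]
    rw [← Finset.sum_add_distrib]
    refine Finset.sum_congr rfl fun a _ => ?_
    split_ifs <;> simp
  have hW₁ : ∀ x z, 0 ≤ W₁ x z := fun x z => Finset.sum_nonneg fun a _ =>
    mul_nonneg (C.enc.nonneg x a) (by split_ifs; exacts [le_rfl, U.nonneg a z])
  have hW₂ : ∀ x z, 0 ≤ W₂ x z := fun x z => Finset.sum_nonneg fun a _ =>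
    mul_nonneg (C.enc.nonneg x a) (by split_ifs; exacts [U.nonneg a z, le_rfl])
  have h1 := f.sum_sum_abs_le_of_dominated m hW₁ hq hK
    (by
      intro x z
      calc W₁ x z ≤ ∑ a, C.enc.prob x a * (K * q z) := by
            refine Finset.sum_le_sum fun a _ => mul_le_mul_of_nonneg_left ?_ (C.enc.nonneg x a)
            split_ifs with hlt
            · exact mul_nonneg hK (hq z)
            · exact not_lt.1 hlt
        _ = K * q z := by rw [← Finset.sum_mul, C.enc.sum_eq_one, one_mul])
    (by
      intro x
      rw [← (C.enc.comp U).sum_eq_one x]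
      refine Finset.sum_le_sum fun z _ => ?_
      rw [hsplit]
      linarith [hW₂ x z]) hB
  have h2 := f.sum_sum_abs_le_of_small m hW₂ (β := β) (by
    intro x
    simp only [W₂]
    rw [Finset.sum_comm]
    calc _ ≤ ∑ a, C.enc.prob x a * β := by
          refine Finset.sum_le_sum fun a _ => ?_
          rw [← Finset.mul_sum]
          rcases eq_or_ne (C.enc.prob x a) 0 with h0 | h0
          · rw [h0, zero_mul, zero_mul]
          · exact mul_le_mul_of_nonneg_left (hβ x a h0) (C.enc.nonneg x a)
      _ = β := by rw [← Finset.sum_mul, C.enc.sum_eq_one, one_mul])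
  have h3 : √(f.lambda2 m * K * B) ≤ √(Λ * K * B) := by
    refine Real.sqrt_le_sqrt ?_
    gcongr
    exact hΛ m m.2
  calc _ ≤ ∑ z, ∑ s,
        (|∑ x, f.randInverse.prob (s, m) x * W₁ x z - (∑ x, W₁ x z) / Fintype.card X| +
        |∑ x, f.randInverse.prob (s, m) x * W₂ x z - (∑ x, W₂ x z) / Fintype.card X|) := by
        refine Finset.sum_le_sum fun z _ => Finset.sum_le_sum fun s _ => ?_
        refine (le_of_eq ?_).trans (abs_add_le _ _)
        congr 1
        simp_rw [hsplit, mul_add, Finset.sum_add_distrib]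
        ring
    _ ≤ Fintype.card S * √(f.lambda2 m * K * B) + Fintype.card S * (2 * β) := by
        simp_rw [Finset.sum_add_distrib]
        exact add_le_add h1 h2
    _ ≤ _ := by
        rw [← mul_add]
        gcongr

/-! ### Error probability of a modular scheme -/

theorem errorProb_modularBRI_le [Fintype Y] (f : BRIFunction S X N) {X₁ : Type*} [Fintype X₁]
    [DecidableEq X₁] {C' : ECCode X A Y} {C : ECCode X₁ A Y} (hC : IsRestriction C' C)
    (T : Channel A Y) : (modularBRI f C').errorProb T ≤ C.errorProb T := by
  obtain ⟨ι, henc, hdec⟩ := hC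
  have hnn : ∀ x : X₁, 0 ≤ ∑ y ∈ Finset.univ.filter (fun y => C.dec y ≠ x),
      (C.enc.comp T).prob x y := fun x => Finset.sum_nonneg fun y _ => Channel.nonneg _ _ _
  refine Real.iSup_le (fun p => ?_) (Real.iSup_nonneg hnn)
  have hx : ∀ x, ∑ y ∈ Finset.univ.filter (fun y => C'.dec y ≠ x), (C'.enc.comp T).prob x y ≤
      C.errorProb T := by
    intro x
    refine le_trans ?_ (le_ciSup (f := fun x : X₁ => ∑ y ∈ Finset.univ.filter
      (fun y => C.dec y ≠ x), (C.enc.comp T).prob x y) (Set.finite_range _).bddAbove (ι x))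
    have e : ∀ y, (C'.enc.comp T).prob x y = (C.enc.comp T).prob (ι x) y := fun y => by
      simp only [Channel.comp, henc]
    simp_rw [e]
    refine Finset.sum_le_sum_of_subset_of_nonneg (fun y hy => ?_)
      fun y _ _ => Channel.nonneg _ _ _
    simp only [Finset.mem_filter, Finset.mem_univ, true_and] at hy ⊢
    exact fun h => hy (hdec y x h)
  obtain ⟨s, m⟩ := p
  calc _ = ∑ x, f.randInverse.prob (s, m) x * ∑ y ∈ Finset.univ.filter
        (fun y => f.toFun s (C'.dec y) ≠ m), (C'.enc.comp T).prob x y := by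
        simp only [modularBRI]
        simp_rw [Channel.comp_assoc_prob, Finset.mul_sum]
        exact Finset.sum_comm
    _ ≤ ∑ x, f.randInverse.prob (s, m) x * C.errorProb T := by
        refine Finset.sum_le_sum fun x _ => ?_
        by_cases hfx : f.toFun s x = m
        · refine mul_le_mul_of_nonneg_left (le_trans ?_ (hx x)) (f.randInverse.nonneg _ _)
          refine Finset.sum_le_sum_of_subset_of_nonneg (fun y hy => ?_)
            fun y _ _ => Channel.nonneg _ _ _
          simp only [Finset.mem_filter, Finset.mem_univ, true_and] at hy ⊢
          rintro rfl
          exact hy hfx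
        · simp [BRIFunction.randInverse, hfx]
    _ = C.errorProb T := by rw [← Finset.sum_mul, f.randInverse.sum_eq_one, one_mul]

theorem errorProb_modularBRI_nonneg [Fintype Y] (f : BRIFunction S X N) (C : ECCode X A Y)
    (T : Channel A Y) : 0 ≤ (modularBRI f C).errorProb T :=
  Real.iSup_nonneg fun _ => Finset.sum_nonneg fun _ _ => Channel.nonneg _ _ _

end Leakage

/-! ### A Chernoff bound for the information density -/

/-- Exponential tail bound for the information density `∑ log (U(zᵢ|aᵢ) / q(zᵢ))` of a fixed
input word `a`, when each summand is bounded by `B` and the mean is at most `n D`. -/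
theorem sum_infoDensity_tail_le {A Z : Type*} [Fintype Z] (U : Channel A Z) {q : Z → ℝ}
    {B α D θ : ℝ} (hq : ∀ z, 0 ≤ q z) (hac : ∀ a z, 0 < U.prob a z → 0 < q z)
    (hB : ∀ a z, |Real.log (U.prob a z / q z)| ≤ B) (hα : 0 ≤ α) (hαB : α * B ≤ 1)
    {n : ℕ} (a : Fin n → A)
    (hD : ∑ i, ∑ z, U.prob (a i) z * Real.log (U.prob (a i) z / q z) ≤ n * D) :
    ∑ z, (if Real.exp (n * θ) * ∏ i, q (z i) < (U.memoryless n).prob a z then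
        (U.memoryless n).prob a z else 0) ≤
      Real.exp (n * (α * D + (α * B) ^ 2 - α * θ)) := by
  set l : A → Z → ℝ := fun a z => Real.log (U.prob a z / q z) with hl
  have hterm : ∀ z : Fin n → Z,
      (if Real.exp (n * θ) * ∏ i, q (z i) < (U.memoryless n).prob a z then
        (U.memoryless n).prob a z else 0) ≤
      Real.exp (-(n * (α * θ))) * ∏ i, (U.prob (a i) (z i) * Real.exp (α * l (a i) (z i))) := by
    intro z
    have hU : (U.memoryless n).prob a z = ∏ i, U.prob (a i) (z i) := rfl
    split_ifs with h
    · have hq0 : 0 ≤ Real.exp (n * θ) * ∏ i, q (z i) :=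
        mul_nonneg (Real.exp_pos _).le (Finset.prod_nonneg fun i _ => hq _)
      have hpos : 0 < ∏ i, U.prob (a i) (z i) := hU ▸ hq0.trans_lt h
      have hUi : ∀ i, 0 < U.prob (a i) (z i) := fun i =>
        (U.nonneg _ _).lt_of_ne fun h0 =>
          hpos.ne' (Finset.prod_eq_zero (Finset.mem_univ i) h0.symm)
      have hqi : ∀ i, 0 < q (z i) := fun i => hac _ _ (hUi i)
      have hqp : 0 < ∏ i, q (z i) := Finset.prod_pos fun i _ => hqi i
      -- on the event in question the sum of the log-likelihood ratios exceeds `n θ`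
      have hsum : n * θ ≤ ∑ i, l (a i) (z i) := by
        have h1 : Real.exp (n * θ) < ∏ i, (U.prob (a i) (z i) / q (z i)) := by
          rw [Finset.prod_div_distrib, lt_div_iff₀ hqp]
          exact h
        rw [hl, ← Real.log_prod fun i _ => (div_pos (hUi i) (hqi i)).ne']
        exact (Real.le_log_iff_exp_le ((Real.exp_pos _).trans h1)).2 h1.le
      rw [hU, Finset.prod_mul_distrib, ← Real.exp_sum, ← Finset.mul_sum, mul_left_comm,
        ← Real.exp_add]
      refine le_mul_of_one_le_right hpos.le (Real.one_le_exp ?_)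
      nlinarith [mul_le_mul_of_nonneg_left hsum hα]
    · exact mul_nonneg (Real.exp_pos _).le (Finset.prod_nonneg fun i _ =>
        mul_nonneg (U.nonneg _ _) (Real.exp_pos _).le)
  have hmgf : ∀ b, ∑ z, U.prob b z * Real.exp (α * l b z) ≤
      Real.exp (α * ∑ z, U.prob b z * l b z + (α * B) ^ 2) := by
    intro b
    calc ∑ z, U.prob b z * Real.exp (α * l b z)
        ≤ ∑ z, U.prob b z * (1 + α * l b z + (α * B) ^ 2) := by
          refine Finset.sum_le_sum fun z _ => mul_le_mul_of_nonneg_left ?_ (U.nonneg b z)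
          have h1 : |α * l b z| ≤ α * B := by
            rw [abs_mul, abs_of_nonneg hα]
            exact mul_le_mul_of_nonneg_left (hB b z) hα
          have h2 := (abs_le.1 (Real.abs_exp_sub_one_sub_id_le (h1.trans hαB))).2
          have h3 : (α * l b z) ^ 2 ≤ (α * B) ^ 2 := sq_le_sq' (abs_le.1 h1).1 (abs_le.1 h1).2
          linarith
      _ = (α * ∑ z, U.prob b z * l b z + (α * B) ^ 2) + 1 := by
          simp_rw [mul_add, Finset.sum_add_distrib, ← Finset.sum_mul, U.sum_eq_one,
            Finset.mul_sum, mul_left_comm α]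
          ring
      _ ≤ _ := Real.add_one_le_exp _
  calc _ ≤ ∑ z : Fin n → Z, Real.exp (-(n * (α * θ))) *
        ∏ i, (U.prob (a i) (z i) * Real.exp (α * l (a i) (z i))) :=
        Finset.sum_le_sum fun z _ => hterm z
    _ = Real.exp (-(n * (α * θ))) * ∏ i, ∑ z, U.prob (a i) z * Real.exp (α * l (a i) z) := by
        rw [← Finset.mul_sum, Fintype.prod_sum fun i z => U.prob (a i) z * Real.exp (α * l (a i) z)]
    _ ≤ Real.exp (-(n * (α * θ))) *
        ∏ i, Real.exp (α * ∑ z, U.prob (a i) z * l (a i) z + (α * B) ^ 2) := by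
        refine mul_le_mul_of_nonneg_left (Finset.prod_le_prod (fun i _ => ?_) fun i _ => hmgf _)
          (Real.exp_pos _).le
        exact Finset.sum_nonneg fun z _ => mul_nonneg (U.nonneg _ _) (Real.exp_pos _).le
    _ ≤ _ := by
        rw [← Real.exp_sum, ← Real.exp_add, Finset.sum_add_distrib, ← Finset.mul_sum]
        refine Real.exp_le_exp.2 ?_
        have h := mul_le_mul_of_nonneg_left hD hα
        simp only [Finset.sum_const, Finset.card_univ, Fintype.card_fin, nsmul_eq_mul]
        simp only [hl]
        linarith

/-! ### Types -/

/-- The type (empirical distribution) of a word. -/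
noncomputable def wordType {A : Type*} [DecidableEq A] {n : ℕ} (a : Fin n → A) (b : A) : ℝ :=
  ((Finset.univ.filter fun i => a i = b).card : ℝ) / n

theorem wordType_mem_stdSimplex {A : Type*} [Fintype A] [DecidableEq A] {n : ℕ} (hn : 1 ≤ n)
    (a : Fin n → A) : wordType a ∈ stdSimplex ℝ A := by
  refine ⟨fun b => div_nonneg (Nat.cast_nonneg _) (Nat.cast_nonneg _), ?_⟩
  have h := Finset.card_eq_sum_card_fiberwise (f := a) (s := Finset.univ) (t := Finset.univ)
    fun _ _ => Finset.mem_coe.2 (Finset.mem_univ _)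
  have hn0 : (n : ℝ) ≠ 0 := by exact_mod_cast (by omega : n ≠ 0)
  simp only [wordType]
  rw [← Finset.sum_div, ← Nat.cast_sum, ← h]
  simp [hn0]

theorem sum_apply_eq_sum_wordType {A : Type*} [Fintype A] [DecidableEq A] {n : ℕ} (hn : 1 ≤ n)
    (a : Fin n → A) (g : A → ℝ) : ∑ i, g (a i) = n * ∑ b, wordType a b * g b := by
  have hn0 : (n : ℝ) ≠ 0 := by exact_mod_cast (by omega : n ≠ 0)
  have h : ∀ b, n * (wordType a b * g b) = ∑ i, if a i = b then g b else 0 := by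
    intro b
    rw [wordType, ← Finset.sum_filter, Finset.sum_const, nsmul_eq_mul]
    field_simp
  rw [Finset.mul_sum]
  simp_rw [h]
  rw [Finset.sum_comm]
  simp

open Classical in
/-- The set of types of words of length `n`. -/
noncomputable def wordTypes (A : Type*) [Fintype A] [DecidableEq A] (n : ℕ) : Finset (A → ℝ) :=
  Finset.univ.image fun a : Fin n → A => wordType a

theorem card_wordTypes_le (A : Type*) [Fintype A] [DecidableEq A] (n : ℕ) :
    (wordTypes A n).card ≤ (n + 1) ^ Fintype.card A := by
  classical
  have hsub : wordTypes A n ⊆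
      Finset.univ.image fun (k : A → Fin (n + 1)) (b : A) => ((k b : ℕ) : ℝ) / n := by
    intro P hP
    obtain ⟨a, -, rfl⟩ := Finset.mem_image.1 hP
    refine Finset.mem_image.2 ⟨fun b => ⟨(Finset.univ.filter fun i => a i = b).card, ?_⟩,
      Finset.mem_univ _, ?_⟩
    · have := Finset.card_le_univ (Finset.univ.filter fun i => a i = b)
      rw [Fintype.card_fin] at this
      omega
    · rfl
  refine (Finset.card_le_card hsub).trans (Finset.card_image_le.trans ?_)
  simp

theorem wordType_mem_wordTypes {A : Type*} [Fintype A] [DecidableEq A] {n : ℕ} (a : Fin n → A) :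
    wordType a ∈ wordTypes A n := by
  classical
  exact Finset.mem_image.2 ⟨a, Finset.mem_univ _, rfl⟩

/-- The output distribution of `U` when the input distribution is the mixture of `P` and the
uniform distribution with weights `1 - η` and `η`. The uniform part keeps the information density
bounded. -/
noncomputable def smoothedOutput {A Z : Type*} [Fintype A] [Fintype Z] (U : Channel A Z) (η : ℝ)
    (P : A → ℝ) (z : Z) : ℝ :=
  ∑ b, ((1 - η) * P b + η / Fintype.card A) * U.prob b z

section Smoothing

variable {A Z : Type*} [Fintype A] [Fintype Z] (U : Channel A Z) {η : ℝ} {P : A → ℝ}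

theorem smoothedOutput_nonneg (h0 : 0 ≤ η) (h1 : η ≤ 1) (hP : P ∈ stdSimplex ℝ A) (z : Z) :
    0 ≤ smoothedOutput U η P z :=
  Finset.sum_nonneg fun b _ => mul_nonneg
    (add_nonneg (mul_nonneg (by linarith) (hP.1 b)) (by positivity)) (U.nonneg b z)

theorem sum_smoothedOutput (hP : P ∈ stdSimplex ℝ A) : ∑ z, smoothedOutput U η P z = 1 := by
  have hA : (Fintype.card A : ℝ) ≠ 0 := by
    have : Nonempty A := by
      by_contra h
      rw [not_nonempty_iff] at h
      simpa using hP.2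
    exact_mod_cast Fintype.card_ne_zero
  simp only [smoothedOutput]
  rw [Finset.sum_comm]
  simp_rw [← Finset.mul_sum, U.sum_eq_one, mul_one, Finset.sum_add_distrib, ← Finset.mul_sum]
  rw [hP.2]
  simp
  field_simp
  ring

theorem mul_prob_le_smoothedOutput (h0 : 0 ≤ η) (h1 : η ≤ 1) (hP : P ∈ stdSimplex ℝ A) (a : A)
    (z : Z) : η / Fintype.card A * U.prob a z ≤ smoothedOutput U η P z := by
  refine le_trans ?_ (Finset.single_le_sum
    (f := fun b => ((1 - η) * P b + η / Fintype.card A) * U.prob b z) (fun b _ => mul_nonneg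
    (add_nonneg (mul_nonneg (by linarith) (hP.1 b)) (by positivity)) (U.nonneg b z))
    (Finset.mem_univ a))
  refine mul_le_mul_of_nonneg_right ?_ (U.nonneg a z)
  have := mul_nonneg (sub_nonneg.2 h1) (hP.1 a)
  linarith

theorem mul_output_le_smoothedOutput (h0 : 0 ≤ η) (z : Z) :
    (1 - η) * ∑ b, P b * U.prob b z ≤ smoothedOutput U η P z := by
  rw [Finset.mul_sum]
  refine Finset.sum_le_sum fun b _ => ?_
  rw [← mul_assoc]
  refine mul_le_mul_of_nonneg_right ?_ (U.nonneg b z)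
  have : 0 ≤ η / Fintype.card A := by positivity
  linarith

/-- A bound for the information density that is uniform in the type. -/
theorem abs_log_div_smoothedOutput_le (h0 : 0 < η) (h1 : η ≤ 1) (hP : P ∈ stdSimplex ℝ A)
    (a : A) (z : Z) : |Real.log (U.prob a z / smoothedOutput U η P z)| ≤
      |Real.log (Fintype.card A / η)| + ∑ b, ∑ y, |Real.log (U.prob b y)| := by
  have hA : (0 : ℝ) < Fintype.card A := by exact_mod_cast Fintype.card_pos_iff.2 ⟨a⟩
  have hsum : |Real.log (U.prob a z)| ≤ ∑ b, ∑ y, |Real.log (U.prob b y)| :=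
    (Finset.single_le_sum (f := fun y => |Real.log (U.prob a y)|) (fun _ _ => abs_nonneg _)
      (Finset.mem_univ z)).trans
    (Finset.single_le_sum (f := fun b => ∑ y, |Real.log (U.prob b y)|)
      (fun _ _ => Finset.sum_nonneg fun _ _ => abs_nonneg _) (Finset.mem_univ a))
  rcases (U.nonneg a z).eq_or_lt with h | h
  · rw [← h]
    simp only [zero_div, Real.log_zero, abs_zero]
    exact add_nonneg (abs_nonneg _) ((abs_nonneg _).trans hsum)
  · have hlow := mul_prob_le_smoothedOutput U h0.le h1 hP a z
    have hq : 0 < smoothedOutput U η P z := lt_of_lt_of_le (by positivity) hlow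
    have hq1 : smoothedOutput U η P z ≤ 1 := by
      rw [← sum_smoothedOutput U (η := η) hP]
      exact Finset.single_le_sum (f := fun z => smoothedOutput U η P z)
        (fun z _ => smoothedOutput_nonneg U h0.le h1 hP z) (Finset.mem_univ z)
    have hu : Real.log (U.prob a z / smoothedOutput U η P z) ≤ Real.log (Fintype.card A / η) := by
      refine Real.log_le_log (by positivity) ?_
      rw [div_le_div_iff₀ hq h0]
      have e : (Fintype.card A : ℝ) * (η / Fintype.card A * U.prob a z) = U.prob a z * η := by
        field_simp
      rw [← e]
      exact mul_le_mul_of_nonneg_left hlow hA.le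
    have hl : Real.log (U.prob a z) ≤ Real.log (U.prob a z / smoothedOutput U η P z) :=
      Real.log_le_log h (by rw [le_div_iff₀ hq]; exact mul_le_of_le_one_right h.le hq1)
    have a1 := le_abs_self (Real.log (Fintype.card A / η))
    have a2 := neg_abs_le (Real.log (U.prob a z))
    rw [abs_le]
    constructor <;> linarith [abs_nonneg (Real.log (Fintype.card A / η)),
      abs_nonneg (Real.log (U.prob a z))]

/-- Smoothing increases the mean information density by at most `-log (1 - η)`. -/
theorem sum_mul_log_div_smoothedOutput_le (P : stdSimplex ℝ A) (h0 : 0 ≤ η) (h1 : η < 1) :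
    ∑ a, (P : A → ℝ) a * ∑ z, U.prob a z * Real.log (U.prob a z / smoothedOutput U η P z) ≤
      channelInfo P U * Real.log 2 - Real.log (1 - η) := by
  have key : ∀ a z, (P : A → ℝ) a * (U.prob a z *
      Real.log (U.prob a z / smoothedOutput U η P z)) ≤
      (P : A → ℝ) a * U.prob a z * Real.log (U.prob a z / ∑ b, (P : A → ℝ) b * U.prob b z) -
        (P : A → ℝ) a * U.prob a z * Real.log (1 - η) := by
    intro a z
    have hPU : 0 ≤ (P : A → ℝ) a * U.prob a z := mul_nonneg (P.2.1 a) (U.nonneg a z)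
    rw [← mul_assoc, ← mul_sub]
    rcases hPU.eq_or_lt with h | h
    · simp [← h]
    refine mul_le_mul_of_nonneg_left ?_ hPU
    have hU : 0 < U.prob a z := (U.nonneg a z).lt_of_ne fun h' => by simp [← h'] at h
    have hq : 0 < ∑ b, (P : A → ℝ) b * U.prob b z :=
      h.trans_le (Finset.single_le_sum (f := fun b => (P : A → ℝ) b * U.prob b z)
        (fun b _ => mul_nonneg (P.2.1 b) (U.nonneg b z)) (Finset.mem_univ a))
    have h1' : 0 < 1 - η := by linarith
    have hle := mul_output_le_smoothedOutput U (P := (P : A → ℝ)) h0 z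
    have hlog := Real.log_le_log (mul_pos h1' hq) hle
    rw [Real.log_mul h1'.ne' hq.ne'] at hlog
    rw [Real.log_div hU.ne' hq.ne', Real.log_div hU.ne' (lt_of_lt_of_le (mul_pos h1' hq) hle).ne']
    linarith
  simp_rw [Finset.mul_sum]
  refine (Finset.sum_le_sum fun a _ => Finset.sum_le_sum fun z _ => key a z).trans_eq ?_
  rw [channelInfo_mul_log_two]
  simp_rw [Finset.sum_sub_distrib, ← Finset.sum_mul, ← Finset.mul_sum, U.sum_eq_one, mul_one]
  rw [show ∑ a, (P : A → ℝ) a = 1 from P.2.2, one_mul]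

end Smoothing

/-- A single measure `q` on output words, of polynomial mass, serves for all input words whose
type has information at most `R` nats: the likelihood `Uⁿ(z|a)` exceeds `exp (n (R + 2κ)) q(z)`
only with exponentially small probability. -/
theorem exists_universal_measure {A Z : Type*} [Fintype A] [DecidableEq A] [Fintype Z]
    (U : Channel A Z) (R : ℝ) {κ : ℝ} (hκ : 0 < κ) :
    ∃ c : ℝ, 0 < c ∧ ∀ n : ℕ, 1 ≤ n → ∃ q : (Fin n → Z) → ℝ, (∀ z, 0 ≤ q z) ∧
      ∑ z, q z ≤ ((n : ℝ) + 1) ^ Fintype.card A ∧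
      ∀ a : Fin n → A, (∀ P : stdSimplex ℝ A, (P : A → ℝ) = wordType a →
          channelInfo P U * Real.log 2 ≤ R) →
        ∑ z, (if Real.exp (n * (R + 2 * κ)) * q z < (U.memoryless n).prob a z then
          (U.memoryless n).prob a z else 0) ≤ Real.exp (-(c * n)) := by
  -- chosen such that smoothing costs exactly `κ` nats
  let η : ℝ := 1 - Real.exp (-κ)
  have hη1 : η < 1 := sub_lt_self _ (Real.exp_pos _)
  have hη0 : 0 < η := sub_pos.2 (by rw [Real.exp_lt_one_iff]; linarith)
  have hηlog : Real.log (1 - η) = -κ := by simp [η]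
  set B : ℝ := 1 + (|Real.log (Fintype.card A / η)| + ∑ b, ∑ y, |Real.log (U.prob b y)|) with hBdef
  have hB1 : 1 ≤ B := le_add_of_nonneg_right (add_nonneg (abs_nonneg _)
    (Finset.sum_nonneg fun _ _ => Finset.sum_nonneg fun _ _ => abs_nonneg _))
  have hB0 : 0 < B := by linarith
  let τ : ℝ := min 1 (κ / 2)
  have hτ : 0 < τ := lt_min one_pos (by linarith)
  let α : ℝ := τ / B ^ 2
  have hα : 0 < α := by positivity
  have hαB : α * B ≤ 1 := by
    have : α * B = τ / B := by simp only [α]; field_simp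
    rw [this, div_le_one hB0]
    exact (min_le_left _ _).trans hB1
  have hαB2 : (α * B) ^ 2 = α * τ := by simp only [α]; field_simp
  refine ⟨α * κ / 2, by positivity, fun n hn => ?_⟩
  have hT : ∀ P ∈ wordTypes A n, P ∈ stdSimplex ℝ A := by
    intro P hP
    obtain ⟨a, -, rfl⟩ := Finset.mem_image.1 hP
    exact wordType_mem_stdSimplex hn a
  have hsm : ∀ P ∈ wordTypes A n, ∀ z : Fin n → Z, 0 ≤ ∏ i, smoothedOutput U η P (z i) :=
    fun P hP z => Finset.prod_nonneg fun i _ => smoothedOutput_nonneg U hη0.le hη1.le (hT P hP) _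
  refine ⟨fun z => ∑ P ∈ wordTypes A n, ∏ i, smoothedOutput U η P (z i),
    fun z => Finset.sum_nonneg fun P hP => hsm P hP z, ?_, fun a ha => ?_⟩
  · rw [Finset.sum_comm]
    have h1 : ∀ P ∈ wordTypes A n, ∑ z : Fin n → Z, ∏ i, smoothedOutput U η P (z i) = 1 := by
      intro P hP
      rw [← Fintype.prod_sum fun (_ : Fin n) z => smoothedOutput U η P z]
      simp [sum_smoothedOutput U (hT P hP)]
    rw [Finset.sum_congr rfl h1]
    simpa using (Nat.cast_le (α := ℝ)).2 (card_wordTypes_le A n)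
  · let P : stdSimplex ℝ A := ⟨wordType a, wordType_mem_stdSimplex hn a⟩
    have hmem := wordType_mem_wordTypes a
    have htail := sum_infoDensity_tail_le U (q := smoothedOutput U η P) (B := B) (α := α)
      (D := R + κ) (θ := R + 2 * κ)
      (fun z => smoothedOutput_nonneg U hη0.le hη1.le P.2 z)
      (fun b z hb => lt_of_lt_of_le (mul_pos (div_pos hη0
        (by exact_mod_cast Fintype.card_pos_iff.2 ⟨b⟩)) hb)
        (mul_prob_le_smoothedOutput U hη0.le hη1.le P.2 b z))
      (fun b z => (abs_log_div_smoothedOutput_le U hη0 hη1.le P.2 b z).trans (by linarith))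
      hα.le hαB a
      (by
        rw [sum_apply_eq_sum_wordType hn a fun b =>
          ∑ z, U.prob b z * Real.log (U.prob b z / smoothedOutput U η P z)]
        refine mul_le_mul_of_nonneg_left ?_ (Nat.cast_nonneg n)
        have h1 := sum_mul_log_div_smoothedOutput_le U P hη0.le hη1
        have h2 := ha P rfl
        rw [hηlog] at h1
        change ∑ b, (P : A → ℝ) b * _ ≤ _
        linarith)
    refine le_trans (Finset.sum_le_sum fun z _ => ?_) (htail.trans (Real.exp_le_exp.2 ?_))
    · have hle : ∏ i, smoothedOutput U η P (z i) ≤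
          ∑ P ∈ wordTypes A n, ∏ i, smoothedOutput U η P (z i) :=
        Finset.single_le_sum (f := fun P => ∏ i, smoothedOutput U η P (z i))
          (fun P hP => hsm P hP z) hmem
      have hle' := mul_le_mul_of_nonneg_left hle (Real.exp_pos (n * (R + 2 * κ))).le
      have hnn := (U.memoryless n).nonneg a z
      split_ifs with c1 c2
      · exact le_rfl
      · exact absurd (hle'.trans_lt c1) c2
      · exact hnn
      · exact le_rfl
    · have hτκ : α * τ ≤ α * (κ / 2) := mul_le_mul_of_nonneg_left (min_le_right _ _) hα.le
      rw [hαB2]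
      have hn0 : (0 : ℝ) ≤ n := Nat.cast_nonneg n
      nlinarith [mul_le_mul_of_nonneg_left hτκ hn0]

/-! ### Asymptotics -/

section Asymptotics

variable {S X N : ℕ → Type*} [∀ n, Fintype (S n)] [∀ n, Fintype (X n)]
  [∀ n, DecidableEq (X n)] [∀ n, DecidableEq (N n)]
  {f : ∀ n, BRIFunction (S n) (X n) (N n)} {r t : ℝ}

theorem HasAsymptotics.tendsto_rate (h : HasAsymptotics f r t) (hr : 0 < r) :
    Tendsto (fun n : ℕ => Real.logb 2 ((f n).regSet.card) / n) atTop (𝓝 ((1 - t) * r)) := by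
  refine (h.rate.mul h.log_card).congr' ?_
  filter_upwards [h.log_card.eventually (lt_mem_nhds hr)] with n hn
  have hX : Real.logb 2 (Fintype.card (X n)) ≠ 0 := fun h0 => by simp [h0] at hn
  field_simp

theorem HasAsymptotics.eventually_lambda2_le (h : HasAsymptotics f r t) (hr : 0 < r) (ht : 0 < t)
    {ρ : ℝ} (hρ : ρ < t * r) :
    ∀ᶠ n : ℕ in atTop, ∀ m ∈ (f n).regSet,
      (f n).lambda2 m ≤ Real.exp (-(ρ * Real.log 2 * n)) := by
  have hl : 0 < Real.log 2 := Real.log_pos one_lt_two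
  obtain ⟨t', ht1, ht2⟩ : ∃ t', max 0 (ρ / r) < t' ∧ t' < t :=
    exists_between (max_lt ht ((div_lt_iff₀ hr).2 hρ))
  obtain ⟨ht0, hρt⟩ := max_lt_iff.1 ht1
  rw [div_lt_iff₀ hr] at hρt
  have hev := eventually_lt_of_lt_liminf
    (lt_of_lt_of_le (EReal.coe_lt_coe_iff.2 ht2) h.eigenvalue)
  filter_upwards [hev, h.log_card.eventually (lt_mem_nhds hr),
    (h.log_card.const_mul t').eventually (lt_mem_nhds hρt), eventually_ge_atTop 1]
    with n h1 h2 h3 hn m hm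
  have hn0 : (0 : ℝ) < n := by exact_mod_cast hn
  set Lx := Real.logb 2 (Fintype.card (X n))
  have hLx : 0 < Lx := by
    rw [lt_div_iff₀ hn0] at h2
    simpa using h2
  rw [← mul_div_assoc, lt_div_iff₀ hn0] at h3
  have hm' : (t' : EReal) < negLog2 ((f n).lambda2 m) / (Lx : EReal) :=
    lt_of_lt_of_le h1 (EReal.div_le_div_right_of_nonneg (by exact_mod_cast hLx.le)
      (iInf₂_le m hm))
  rcases le_or_gt ((f n).lambda2 m) 0 with h0 | h0
  · exact h0.trans (Real.exp_pos _).le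
  · rw [negLog2, if_neg (not_le.2 h0), ← EReal.coe_div, EReal.coe_lt_coe_iff, lt_div_iff₀ hLx,
      Real.logb] at hm'
    have h4 : ρ * n < -(Real.log ((f n).lambda2 m) / Real.log 2) := h3.trans hm'
    rw [← neg_div, lt_div_iff₀ hl] at h4
    rw [← Real.log_le_iff_le_exp h0]
    linarith

end Asymptotics

/-- A polynomial factor is absorbed by halving the exponent. -/
theorem exists_pow_mul_exp_le (j : ℕ) {b : ℝ} (hb : 0 < b) :
    ∃ K : ℝ, 0 ≤ K ∧ ∀ n : ℕ,
      ((n : ℝ) + 1) ^ j * Real.exp (-(b * n)) ≤ K * Real.exp (-(b / 2 * n)) := by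
  refine ⟨(2 / b) ^ j * j.factorial * Real.exp (b / 2), by positivity, fun n => ?_⟩
  have h := Real.pow_div_factorial_le_exp (x := b / 2 * (n + 1)) (by positivity) j
  rw [div_le_iff₀ (by positivity), mul_pow] at h
  have h1 : ((n : ℝ) + 1) ^ j ≤ (2 / b) ^ j * j.factorial * Real.exp (b / 2 * (n + 1)) := by
    have h2 := mul_le_mul_of_nonneg_left h (by positivity : 0 ≤ (2 / b) ^ j)
    rw [← mul_assoc, ← mul_pow, show 2 / b * (b / 2) = 1 by field_simp, one_pow, one_mul] at h2
    linarith
  refine (mul_le_mul_of_nonneg_right h1 (Real.exp_pos _).le).trans_eq ?_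
  rw [mul_assoc, mul_assoc _ (Real.exp (b / 2)), ← Real.exp_add, ← Real.exp_add]
  congr 2
  ring

/-- An eventual exponential bound extends to all indices at the cost of the constant. -/
theorem exists_forall_le_mul_of_eventually {u v : ℕ → ℝ} {K : ℝ} (hv : ∀ n, 0 < v n)
    (h : ∀ᶠ n in atTop, u n ≤ K * v n) : ∃ K', ∀ n, u n ≤ K' * v n := by
  obtain ⟨n₀, hn₀⟩ := eventually_atTop.1 h
  have hs : ∀ n, 0 ≤ |u n / v n| := fun n => abs_nonneg _
  refine ⟨|K| + ∑ i ∈ Finset.range n₀, |u i / v i|, fun n => ?_⟩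
  rcases le_or_gt n₀ n with hn | hn
  · refine (hn₀ n hn).trans (mul_le_mul_of_nonneg_right ?_ (hv n).le)
    have := Finset.sum_nonneg fun i (_ : i ∈ Finset.range n₀) => hs i
    linarith [le_abs_self K]
  · rw [← div_le_iff₀ (hv n)]
    have := Finset.single_le_sum (f := fun i => |u i / v i|) (fun i _ => hs i)
      (Finset.mem_range.2 hn)
    linarith [le_abs_self (u n / v n), abs_nonneg K]

section Achievability

variable {S X N : ℕ → Type*} [∀ n, Fintype (S n)] [∀ n, Fintype (X n)]
  [∀ n, DecidableEq (X n)] [∀ n, DecidableEq (N n)]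
  {f : ∀ n, BRIFunction (S n) (X n) (N n)} {r t : ℝ}
  {A Y Z : Type*} [Fintype A] [DecidableEq A] [Fintype Y] [Fintype Z]

/-- If, for large `n`, all channel inputs used by the codes have types with information at most
`R < t r` over the eavesdropper's channel, then the leakage decreases exponentially. -/
theorem exponentialLeakage_of_channelInfo_le (h : HasAsymptotics f r t) (hr : 0 < r) (ht : 0 < t)
    (U : Channel A Z) (C : ∀ n, ECCode (X n) (Fin n → A) (Fin n → Y)) {R : ℝ}
    (hR : R < t * r)
    (hC : ∀ᶠ n in atTop, ∀ x a, (C n).enc.prob x a ≠ 0 → ∀ P : stdSimplex ℝ A,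
      (P : A → ℝ) = wordType a → channelInfo P U ≤ R) :
    ExponentialLeakage U (fun n => modularBRI (f n) (C n)) := by
  have hl : 0 < Real.log 2 := Real.log_pos one_lt_two
  -- the gap `t r - R`, which is `8 κ` in nats, pays for smoothing, tail bound and eigenvalues
  let κ : ℝ := (t * r - R) * Real.log 2 / 8
  have hκ : 0 < κ := by have := sub_pos.2 hR; positivity
  have hκ8 : 8 * κ = (t * r - R) * Real.log 2 := by simp only [κ]; ring
  obtain ⟨c, hc, huniv⟩ := exists_universal_measure U (R * Real.log 2) hκ
  have hρ : t * r - 2 * κ / Real.log 2 < t * r := by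
    have : 0 < 2 * κ / Real.log 2 := by positivity
    linarith
  have hlam := h.eventually_lambda2_le hr ht hρ
  have hρ' : (t * r - 2 * κ / Real.log 2) * Real.log 2 = t * r * Real.log 2 - 2 * κ := by
    field_simp
  rw [hρ'] at hlam
  set k := Fintype.card A
  let b : ℝ := min κ c
  have hb : 0 < b := lt_min hκ hc
  obtain ⟨K, hK, hpoly⟩ := exists_pow_mul_exp_le (k + 1) hb
  have hev : ∀ᶠ n : ℕ in atTop, (modularBRI (f n) (C n)).semLeakage (U.memoryless n) ≤
      3 * (r + 3) * K * (2 : ℝ) ^ (-(b / 2 / Real.log 2 * n)) := by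
    filter_upwards [hlam, hC, eventually_ge_atTop 1,
      h.log_card.eventually (gt_mem_nhds (lt_add_one r))] with n h1 h2 hn h3
    have hn0 : (0 : ℝ) < n := by exact_mod_cast hn
    obtain ⟨q, hq0, hqB, hqtail⟩ := huniv n hn
    have hmain := semLeakage_le_of_truncation (f n) (C n) (U.memoryless n) hq0
      (Real.exp_pos (n * (R * Real.log 2 + 2 * κ))).le hqB (Real.exp_pos (-(c * n))).le
      (fun x a hxa => hqtail a fun P hP => mul_le_mul_of_nonneg_right (h2 x a hxa P hP) hl.le)
      h1
    have hone : (1 : ℝ) ≤ ((n : ℝ) + 1) ^ k := one_le_pow₀ (by linarith)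
    have hsqrt : √(Real.exp (-((t * r * Real.log 2 - 2 * κ) * n)) *
        Real.exp (n * (R * Real.log 2 + 2 * κ)) * ((n : ℝ) + 1) ^ k) ≤
        ((n : ℝ) + 1) ^ k * Real.exp (-(b * n)) := by
      refine Real.sqrt_le_iff.2 ⟨by positivity, ?_⟩
      rw [mul_pow, ← Real.exp_add, mul_comm, ← Real.exp_nat_mul]
      refine mul_le_mul (le_self_pow₀ hone two_ne_zero) (Real.exp_le_exp.2 ?_)
        (Real.exp_pos _).le (by positivity)
      have : b * n ≤ κ * n := mul_le_mul_of_nonneg_right (min_le_left _ _) hn0.le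
      have e : -((t * r * Real.log 2 - 2 * κ) * n) + n * (R * Real.log 2 + 2 * κ) =
          -(4 * κ * n) := by linear_combination (n : ℝ) * hκ8
      rw [e]
      push_cast
      nlinarith
    have htail : Real.exp (-(c * n)) ≤ ((n : ℝ) + 1) ^ k * Real.exp (-(b * n)) := by
      refine le_trans (Real.exp_le_exp.2 ?_) (le_mul_of_one_le_left (Real.exp_pos _).le hone)
      have : b * n ≤ c * n := mul_le_mul_of_nonneg_right (min_le_right _ _) hn0.le
      linarith
    have hlog : (1 + Real.log (Fintype.card (X n))) / Real.log 2 ≤ (r + 3) * (n + 1) := by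
      have hX : Real.log (Fintype.card (X n)) / Real.log 2 ≤ (r + 1) * n :=
        ((div_lt_iff₀ hn0).1 h3).le
      have h2 : 1 / Real.log 2 ≤ 2 := by
        rw [div_le_iff₀ hl]; linarith [Real.log_two_gt_d9]
      rw [add_div]
      nlinarith
    have hpow : Real.exp (-(b / 2 * n)) = (2 : ℝ) ^ (-(b / 2 / Real.log 2 * n)) := by
      rw [Real.rpow_def_of_pos two_pos]
      congr 1
      field_simp
    refine hmain.trans ?_
    calc _ ≤ (r + 3) * (n + 1) * (3 * (((n : ℝ) + 1) ^ k * Real.exp (-(b * n)))) :=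
          mul_le_mul hlog (by linarith) (by positivity) (by positivity)
      _ = 3 * (r + 3) * (((n : ℝ) + 1) ^ (k + 1) * Real.exp (-(b * n))) := by ring
      _ ≤ 3 * (r + 3) * (K * Real.exp (-(b / 2 * n))) :=
          mul_le_mul_of_nonneg_left (hpoly n) (by positivity)
      _ = _ := by rw [hpow]; ring
  obtain ⟨K', hK'⟩ := exists_forall_le_mul_of_eventually
    (fun n => Real.rpow_pos_of_pos two_pos _) hev
  exact ⟨K', b / 2 / Real.log 2, by positivity, hK'⟩

omit [DecidableEq A] in
theorem ExponentialLeakage.tendsto_zero {U : Channel A Z}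
    {C : ∀ n, ECCode (X n) (Fin n → A) (Fin n → Y)}
    (h : ExponentialLeakage U (fun n => modularBRI (f n) (C n))) :
    Tendsto (fun n => (modularBRI (f n) (C n)).semLeakage (U.memoryless n)) atTop (𝓝 0) := by
  obtain ⟨K, c, hc, hle⟩ := h
  refine squeeze_zero (fun n => semLeakage_nonneg _ _ _) hle ?_
  have h1 : Tendsto (fun n : ℕ => ((2 : ℝ) ^ (-c)) ^ n) atTop (𝓝 0) :=
    tendsto_pow_atTop_nhds_zero_of_lt_one (by positivity)
      (Real.rpow_lt_one_of_one_lt_of_neg one_lt_two (by linarith))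
  have h2 := h1.const_mul K
  rw [mul_zero] at h2
  refine h2.congr fun n => ?_
  rw [← Real.rpow_natCast, ← Real.rpow_mul two_pos.le, neg_mul]

/-- Both parts of the theorem are instances of this one: for every restriction of good codes whose
input words have types with information at most `R < t r`, rate, error and leakage are as
desired. -/
theorem achievesSemanticRate_of_channelInfo_le (h : HasAsymptotics f r t) (hr : 0 ≤ r)
    (ht : 0 ≤ t) (T : Channel A Y) (U : Channel A Z)
    {X₁ : ℕ → Type*} [∀ n, Fintype (X₁ n)] [∀ n, DecidableEq (X₁ n)]
    {C : ∀ n, ECCode (X₁ n) (Fin n → A) (Fin n → Y)}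
    (hT : Tendsto (fun n => (C n).errorProb (T.memoryless n)) atTop (𝓝 0))
    {C' : ∀ n, ECCode (X n) (Fin n → A) (Fin n → Y)}
    (hres : ∀ᶠ n in atTop, IsRestriction (C' n) (C n)) {R : ℝ} (hR0 : 0 ≤ R) (hR : R < t * r)
    (hC : ∀ᶠ n in atTop, ∀ x a, (C n).enc.prob x a ≠ 0 → ∀ P : stdSimplex ℝ A,
      (P : A → ℝ) = wordType a → channelInfo P U ≤ R) :
    AchievesSemanticRate T U (fun n => modularBRI (f n) (C' n)) ((1 - t) * r) ∧
      ExponentialLeakage U (fun n => modularBRI (f n) (C' n)) := by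
  have htr : 0 < t * r := hR0.trans_lt hR
  have hr' : 0 < r := hr.lt_of_ne fun h0 => by simp [← h0] at htr
  have ht' : 0 < t := ht.lt_of_ne fun h0 => by simp [← h0] at htr
  have hleak : ExponentialLeakage U (fun n => modularBRI (f n) (C' n)) := by
    refine exponentialLeakage_of_channelInfo_le h hr' ht' U C' hR ?_
    filter_upwards [hC, hres] with n hn ⟨ι, henc, _⟩ x a hxa
    exact hn (ι x) a (by rwa [← henc])
  refine ⟨⟨?_, ?_, hleak.tendsto_zero⟩, hleak⟩
  · exact ((continuous_coe_real_ereal.tendsto _).comp (h.tendsto_rate hr')).liminf_eq.ge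
  · refine squeeze_zero' (Eventually.of_forall fun n => errorProb_modularBRI_nonneg _ _ _) ?_ hT
    filter_upwards [hres] with n hn
    exact errorProb_modularBRI_le (f n) hn _

end Achievability

theorem eventually_card_le_card {X X₁ : ℕ → Type*} [∀ n, Fintype (X n)] [∀ n, Fintype (X₁ n)]
    {r r₁ : ℝ} (hr : r < r₁)
    (hX : Tendsto (fun n : ℕ => Real.logb 2 (Fintype.card (X n)) / n) atTop (𝓝 r))
    (hX₁ : (r₁ : EReal) ≤ liminf
      (fun n : ℕ => ((Real.logb 2 (Fintype.card (X₁ n)) / n : ℝ) : EReal)) atTop) :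
    ∀ᶠ n in atTop, Fintype.card (X n) ≤ Fintype.card (X₁ n) := by
  obtain ⟨ρ, h1, h2⟩ := exists_between hr
  filter_upwards [hX.eventually (gt_mem_nhds h1), eventually_lt_of_lt_liminf
    (lt_of_lt_of_le (EReal.coe_lt_coe_iff.2 h2) hX₁)] with n h3 h4
  rw [EReal.coe_lt_coe_iff] at h4
  by_contra! hlt
  refine (h3.trans h4).not_ge (div_le_div_of_nonneg_right ?_ (Nat.cast_nonneg n))
  rcases Nat.eq_zero_or_pos (Fintype.card (X₁ n)) with h0 | h0
  · rw [h0, Nat.cast_zero, Real.logb_zero]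
    exact Real.logb_nonneg one_lt_two (by exact_mod_cast (by omega : 1 ≤ Fintype.card (X n)))
  · exact Real.logb_le_logb_of_le one_lt_two (by exact_mod_cast h0) (by exact_mod_cast hlt.le)

end BRIWiretap

open BRIWiretap in
theorem mainTheorem7 :
    ∃ γ : ℝ → ℕ → ℕ → ℝ,
      (∀ (δ : ℝ) (a z : ℕ), 0 < δ → 0 < γ δ a z) ∧
      (∀ a z : ℕ, Tendsto (fun δ => γ δ a z) (𝓝[>] 0) (𝓝 0)) ∧
      ∀ (r t : ℝ), 0 ≤ r → 0 ≤ t → t < 1 →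
      -- a sequence of biregular irreducible functions with parameters `r` and `t`
      ∀ (S X N : ℕ → Type*) [∀ n, Fintype (S n)] [∀ n, Fintype (X n)]
        [∀ n, DecidableEq (X n)] [∀ n, DecidableEq (N n)]
        (f : ∀ n, BRIFunction (S n) (X n) (N n)), HasAsymptotics f r t →
      -- a discrete wiretap channel
      ∀ (A Y Z : Type*) [Fintype A] [DecidableEq A] [Fintype Y] [Fintype Z]
        (T : Channel A Y) (U : Channel A Z)
      -- codes for `T` achieving a rate strictly larger than `r`
        (X₁ : ℕ → Type*) [∀ n, Fintype (X₁ n)] [∀ n, DecidableEq (X₁ n)]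
        (C : ∀ n, ECCode (X₁ n) (Fin n → A) (Fin n → Y)),
        (∃ r₁ : ℝ, r < r₁ ∧ CodesAchieveRate T C r₁) →
        -- the message sets can be embedded for all large `n`
        (∀ᶠ n in atTop, Fintype.card (X n) ≤ Fintype.card (X₁ n)) ∧
        -- and however this is done, the modular schemes are secure
        ∀ C' : ∀ n, ECCode (X n) (Fin n → A) (Fin n → Y),
          (∀ᶠ n in atTop, IsRestriction (C' n) (C n)) →
          (maxChannelInfo U < t * r →
            AchievesSemanticRate T U (fun n => modularBRI (f n) (C' n)) ((1 - t) * r) ∧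
            ExponentialLeakage U (fun n => modularBRI (f n) (C' n))) ∧
          (∀ (P : stdSimplex ℝ A) (δ₁ : ℝ), 0 < δ₁ →
            (∀ n : ℕ, 1 ≤ n → ∀ (x : X₁ n) (a : Fin n → A),
              (C n).enc.prob x a ≠ 0 → a ∈ typicalSet P δ₁ n) →
            channelInfo P U + γ δ₁ (Fintype.card A) (Fintype.card Z) < t * r →
            AchievesSemanticRate T U (fun n => modularBRI (f n) (C' n)) ((1 - t) * r) ∧
            ExponentialLeakage U (fun n => modularBRI (f n) (C' n))) := by
  refine ⟨infoModulus, fun δ a z hδ => infoModulus_pos a z hδ, tendsto_infoModulus, ?_⟩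
  intro r t hr ht _ S X N _ _ _ _ f hf A Y Z _ _ _ _ T U X₁ _ _ C hC
  obtain ⟨r₁, hr₁, hrate, herr⟩ := hC
  refine ⟨eventually_card_le_card hr₁ hf.log_card hrate, fun C' hC' => ⟨fun hmax => ?_, ?_⟩⟩
  · exact achievesSemanticRate_of_channelInfo_le hf hr ht T U herr hC' (maxChannelInfo_nonneg U)
      hmax (Eventually.of_forall fun n x a _ P _ => channelInfo_le_maxChannelInfo P U)
  · intro P δ₁ hδ₁ htyp hinfo
    refine achievesSemanticRate_of_channelInfo_le hf hr ht T U herr hC'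
      (add_nonneg (channelInfo_nonneg P U) (infoModulus_pos _ _ hδ₁).le) hinfo ?_
    filter_upwards [eventually_ge_atTop 1] with n hn x a hxa P' hP'
    refine channelInfo_le_add_infoModulus P P' U hδ₁ fun b => ?_
    rw [hP']
    exact (htyp n hn x a hxa b).1
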